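/- Let $n\ge 1$. For $k\ge 1$ and $\zeta\in\mathbb C^k$ write $|\zeta|$ for the Euclidean norm and $|\zeta|_{\mathbb C}^2=\sum_j\zeta_j^2$; let $|\zeta|_{\mathbb C}$ be the square root of $|\zeta|_{\mathbb C}^2$ with positive real part when $|\zeta|_{\mathbb C}^2\notin(-\infty,0]$. The Lie ball in $\mathbb C^k$ is $$L_k=\{\zeta\in\mathbb C^k : |\zeta|^2+\sqrt{|\zeta|^4-\big||\zeta|_{\mathbb C}^2\big|^2}<1\}.$$ Let $B=\{x\in\mathbb R^{n+1}:|x|<1\}$, and number the coordinates of $\mathbb R^{n+1}$ and $\mathbb C^{n+1}$ as $0,\dots,n$. For $\zeta\in\mathbb C^{n+1}$ let $\gamma_{\mathbb C}(\zeta)$ be the set of $x\in\mathbb R^{n+1}$ with $|x-\zeta|_{\mathbb C}^2=0$ if $n$ is odd, and with $|x-\zeta|_{\mathbb C}^2\in(-\infty,0]$ if $n$ is even. For $\Omega\subset\mathbb R^{n+1}$ let $\kappa(\Omega)=\{\zeta\in\mathbb C^{n+1}:\gamma_{\mathbb C}(\zeta)\subset\Omega\}$. Let $\mathbb C_{(n)}$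 be the complex Clifford algebra with generators $e_1,\dots,e_n$, $e_j^2=-1$, $e_je_k=-e_ke_j$ $(j\ne k)$, and unit $e_0=1$. For $\mathbb F=\mathbb R$ or $\mathbb C$, $U\subset\mathbb F^{n+1}$ open and $f:U\to\mathbb C_{(n)}$ continuously differentiable over $\mathbb F$, put $Df=\sum_{j=0}^n e_j\,\partial_jf$. Let $M(U)$ ($\mathbb F=\mathbb R$, left monogenic functions) and $CR(U)$ ($\mathbb F=\mathbb C$, left complex regular functions) be the sets of such $f$ with $Df=0$ on $U$. Let $\sigma_n=2\pi^{(n+1)/2}/\Gamma(\frac{n+1}2)$ and, for $\omega\in\mathbb R^{n+1}$ and $\zeta\in\mathbb C^{n+1}$ with $|\omega-\zeta|_{\mathbb C}^{2}\notin(-\infty,0]$ ($n$ even) or $|\omega-\zeta|_{\mathbb C}^{2}\ne0$ ($n$ odd, where $|\omega-\zeta|_{\mathbb C}^{n+1}=(|\omega-\zeta|_{\mathbb C}^2)^{(n+1)/2}$), $$G_\omega(\zeta)=\frac1{\sigma_n}\,\frac{(\omega_0-\zeta_0)e_0-\sum_{j=1}^n(\omega_j-\zeta_j)e_j}{|\omega-\zeta|_{\mathbb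 C}^{n+1}}.$$ Then: 1. $\kappa(B)=L_{n+1}$. This set equals $\{\xi+i\eta:\ \xi,\eta\in\mathbb R^{n+1},\ |\xi|^2+|\eta|^2+2(|\xi|^2|\eta|^2-\langle\xi,\eta\rangle^2)^{1/2}<1\}$, and it is open and connected. 2. $\gamma_{\mathbb C}(x)=\{x\}$ for every $x\in\mathbb R^{n+1}$, so $B\subset\kappa(B)$. 3. $L_{n+1}\cap(\{0\}\times\mathbb C^n)=\{0\}\times L_n$. 4. Restriction to $B$ is a bijection $v:CR(L_{n+1})\to M(B)$. That is, every $f\in M(B)$ has a unique extension $\tilde f\in CR(L_{n+1})$. Moreover, for every $0<r<1$ and $\zeta\in rL_{n+1}$, $$\tilde f(\zeta)=\int_{rS^n}G_\omega(\zeta)\,\boldsymbol n(\omega)\,f(\omega)\,d\mu(\omega),$$ where $rS^n$ is the sphere of radius $r$ about $0$ in $\mathbb R^{n+1}$, $\mu$ is its surface measure, $\boldsymbol n(\omega)=\omega/r$ is its outward unit normal (regarded as an element of $\mathbb C_{(n)}$ through $x\mapsto\sum_{j=0}^n x_je_j$), and the integrand is integrable. -/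

import Mathlib

open scoped RealInnerProductSpace

noncomputable section

namespace CliffordLie

/-! ### The complex Clifford algebra on `n` generators -/

/-- The complex Clifford algebra with `n` generators: an element `u = ∑ S, u_S e_S` is given by its
coefficients `u_S ∈ ℂ` with respect to the basis `e_S`, where `S` runs over the subsets of the set of
generators; the norm is `|u| = (∑ S, |u_S|²)^(1/2)`. -/
def Cliff (n : ℕ) : Type := EuclideanSpace ℂ (Finset (Fin n))

namespace Cliff

variable {n : ℕ}

instance : NormedAddCommGroup (Cliff n) :=
  inferInstanceAs (NormedAddCommGroup (EuclideanSpace ℂ (Finset (Fin n))))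

instance : InnerProductSpace ℂ (Cliff n) :=
  inferInstanceAs (InnerProductSpace ℂ (EuclideanSpace ℂ (Finset (Fin n))))

instance : FiniteDimensional ℂ (Cliff n) :=
  inferInstanceAs (FiniteDimensional ℂ (EuclideanSpace ℂ (Finset (Fin n))))

/-- The coefficient `u_S`. -/
def coeff (u : Cliff n) (S : Finset (Fin n)) : ℂ := WithLp.ofLp (p := 2) (V := Finset (Fin n) → ℂ) u S

/-- The basis vector `e_S`. -/
def e (S : Finset (Fin n)) : Cliff n := EuclideanSpace.single S (1 : ℂ)

theorem ext_coeff {u v : Cliff n} (h : ∀ S, u.coeff S = v.coeff S) : u = v :=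
  PiLp.ext (p := 2) h

@[simp] theorem coeff_add (u v : Cliff n) (S) : (u + v).coeff S = u.coeff S + v.coeff S := rfl

@[simp] theorem coeff_zero (S) : (0 : Cliff n).coeff S = 0 := rfl

@[simp] theorem coeff_smul (c : ℂ) (u : Cliff n) (S) : (c • u).coeff S = c * u.coeff S := rfl

theorem coeff_e (S T : Finset (Fin n)) : (e S).coeff T = if T = S then 1 else 0 := by
  simp [coeff, e]

@[simp] theorem coeff_sum {ι : Type*} (s : Finset ι) (f : ι → Cliff n) (S) :
    (∑ i ∈ s, f i).coeff S = ∑ i ∈ s, (f i).coeff S := by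
  classical
  induction s using Finset.induction_on with
  | empty => simp
  | insert a s ha ih => simp [Finset.sum_insert ha, ih]

/-- The sign in `e_S e_R = ± e_{S ∆ R}`: reordering the product `e_S e_R` costs a factor `-1` for each
pair `i ∈ S`, `j ∈ R` with `j < i` (anticommutation), and a factor `-1` for each common index
(`e_j² = -1`). -/
def sgn (S R : Finset (Fin n)) : ℂ := ∏ i ∈ S, ∏ j ∈ R, if j ≤ i then -1 else 1

/-- The product `u v = ∑_{S,R} u_S v_R e_S e_R`. -/
instance : Mul (Cliff n) :=
  ⟨fun u v => ∑ S, ∑ R, (u.coeff S * v.coeff R) • (sgn S R • e (symmDiff S R))⟩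

/-- The unit is `e_0 = e_∅`. -/
instance : One (Cliff n) := ⟨e ∅⟩

theorem mul_def (u v : Cliff n) :
    u * v = ∑ S, ∑ R, (u.coeff S * v.coeff R) • (sgn S R • e (symmDiff S R)) := rfl

theorem one_def : (1 : Cliff n) = e ∅ := rfl

theorem coeff_mul (u v : Cliff n) (T : Finset (Fin n)) :
    (u * v).coeff T = ∑ S, u.coeff S * v.coeff (symmDiff S T) * sgn S (symmDiff S T) := by
  rw [mul_def]
  simp only [coeff_sum, coeff_smul, coeff_e]
  refine Finset.sum_congr rfl fun S _ => ?_
  rw [Finset.sum_eq_single (symmDiff S T)]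
  · simp
  · intro R _ hR
    rw [if_neg]
    · simp
    · rintro rfl
      exact hR (by simp)
  · simp

theorem prod_symmDiff {ι : Type*} [DecidableEq ι] (f : ι → ℂ) (hf : ∀ i, f i * f i = 1) (S R : Finset ι) :
    ∏ i ∈ symmDiff S R, f i = (∏ i ∈ S, f i) * ∏ i ∈ R, f i := by
  have h1 : ∏ i ∈ S, f i = (∏ i ∈ S \ R, f i) * ∏ i ∈ S ∩ R, f i := by
    rw [mul_comm, Finset.prod_inter_mul_prod_sdiff]
  have h2 : ∏ i ∈ R, f i = (∏ i ∈ R \ S, f i) * ∏ i ∈ S ∩ R, f i := by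
    rw [mul_comm, Finset.inter_comm, Finset.prod_inter_mul_prod_sdiff]
  have h3 : (∏ i ∈ S ∩ R, f i) * ∏ i ∈ S ∩ R, f i = 1 := by
    rw [← Finset.prod_mul_distrib]; simp [hf]
  have h4 : ∏ i ∈ symmDiff S R, f i = (∏ i ∈ S \ R, f i) * ∏ i ∈ R \ S, f i := by
    rw [symmDiff_def, Finset.sup_eq_union, Finset.prod_union]
    exact disjoint_sdiff_sdiff
  rw [h1, h2, h4]
  linear_combination (-(∏ i ∈ S \ R, f i) * ∏ i ∈ R \ S, f i) * h3

theorem sgn_symmDiff_left (S S' R : Finset (Fin n)) :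
    sgn (symmDiff S S') R = sgn S R * sgn S' R := by
  unfold sgn
  refine prod_symmDiff _ (fun i => ?_) S S'
  rw [← Finset.prod_mul_distrib]
  refine Finset.prod_eq_one fun j _ => ?_
  split_ifs <;> norm_num

theorem sgn_symmDiff_right (S R R' : Finset (Fin n)) :
    sgn S (symmDiff R R') = sgn S R * sgn S R' := by
  unfold sgn
  rw [← Finset.prod_mul_distrib]
  refine Finset.prod_congr rfl fun i _ => ?_
  refine prod_symmDiff _ (fun j => ?_) R R'
  split_ifs <;> norm_num

/-- Left translation by `P` in the group of subsets under symmetric difference. -/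
def symmEquiv (P : Finset (Fin n)) : Finset (Fin n) ≃ Finset (Fin n) where
  toFun S := symmDiff P S
  invFun S := symmDiff P S
  left_inv S := by simp
  right_inv S := by simp

protected theorem mul_assoc' (u v w : Cliff n) : u * v * w = u * (v * w) := by
  refine ext_coeff fun T => ?_
  simp only [coeff_mul, Finset.sum_mul, Finset.mul_sum]
  rw [Finset.sum_comm]
  refine Finset.sum_congr rfl fun P _ => ?_
  rw [← (symmEquiv P).sum_comp]
  refine Finset.sum_congr rfl fun Q _ => ?_
  have h1 : symmDiff P (symmDiff P Q) = Q := by simp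
  have h2 : symmDiff (symmDiff P Q) T = symmDiff Q (symmDiff P T) := by
    rw [symmDiff_comm P Q, symmDiff_assoc]
  have h3 : sgn P (symmDiff P T) = sgn P Q * sgn P (symmDiff Q (symmDiff P T)) := by
    rw [← sgn_symmDiff_right]; simp
  simp only [symmEquiv, Equiv.coe_fn_mk, h1, h2, h3, sgn_symmDiff_left]
  ring

instance : Ring (Cliff n) :=
  { (inferInstance : AddCommGroup (Cliff n)), (inferInstance : Mul (Cliff n)),
    (inferInstance : One (Cliff n)) with
    left_distrib := fun u v w => ext_coeff fun T => by
      simp only [coeff_mul, coeff_add, ← Finset.sum_add_distrib]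
      exact Finset.sum_congr rfl fun S _ => by ring
    right_distrib := fun u v w => ext_coeff fun T => by
      simp only [coeff_mul, coeff_add, ← Finset.sum_add_distrib]
      exact Finset.sum_congr rfl fun S _ => by ring
    zero_mul := fun u => ext_coeff fun T => by simp [coeff_mul]
    mul_zero := fun u => ext_coeff fun T => by simp [coeff_mul]
    mul_assoc := Cliff.mul_assoc'
    one_mul := fun u => ext_coeff fun T => by
      have h0 : symmDiff ∅ T = T := bot_symmDiff T
      rw [coeff_mul, Finset.sum_eq_single ∅]
      · simp [one_def, coeff_e, sgn, h0]
      · intro S _ hS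
        simp [one_def, coeff_e, hS]
      · simp
    mul_one := fun u => ext_coeff fun T => by
      rw [coeff_mul, Finset.sum_eq_single T]
      · simp [one_def, coeff_e, sgn]
      · intro S _ hS
        have : symmDiff S T ≠ ∅ := by
          rw [← Finset.bot_eq_empty]; exact fun h => hS (symmDiff_eq_bot.1 h)
        simp [one_def, coeff_e, this]
      · simp }

instance : Algebra ℂ (Cliff n) :=
  Algebra.ofModule
    (fun c u v => ext_coeff fun T => by
      simp only [coeff_mul, coeff_smul, Finset.mul_sum]
      exact Finset.sum_congr rfl fun S _ => by ring)
    (fun c u v => ext_coeff fun T => by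
      simp only [coeff_mul, coeff_smul, Finset.mul_sum]
      exact Finset.sum_congr rfl fun S _ => by ring)

/-! The defining relations of the Clifford algebra. -/

theorem e_mul_e (S R : Finset (Fin n)) : e S * e R = sgn S R • e (symmDiff S R) := by
  rw [mul_def, Finset.sum_eq_single S, Finset.sum_eq_single R]
  · simp [coeff_e]
  · intro b _ hb; simp [coeff_e, hb]
  · simp
  · intro b _ hb; simp [coeff_e, hb]
  · simp

theorem e_mul_self (j : Fin n) : e {j} * e {j} = -1 := by
  rw [e_mul_e]; simp [sgn, one_def]

/-- `e_{j₁} e_{j₂} ⋯ e_{jₛ} = e_{{j₁, …, jₛ}}` for `j₁ < j₂ < ⋯ < jₛ`, one factor at a time. -/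
theorem e_mul_of_lt (j : Fin n) (S : Finset (Fin n)) (h : ∀ k ∈ S, j < k) :
    e {j} * e S = e (insert j S) := by
  have hj : j ∉ S := fun hS => lt_irrefl j (h j hS)
  have h1 : symmDiff {j} S = insert j S := by
    rw [Finset.insert_eq]
    exact (Finset.disjoint_singleton_left.2 hj).symmDiff_eq_sup
  have h2 : sgn {j} S = 1 := by
    simp only [sgn, Finset.prod_singleton]
    exact Finset.prod_eq_one fun k hk => if_neg (not_le.2 (h k hk))
  rw [e_mul_e, h1, h2, one_smul]

theorem e_mul_e_anticomm (j k : Fin n) (h : j ≠ k) : e {j} * e {k} = -(e {k} * e {j}) := by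
  rw [e_mul_e, e_mul_e, symmDiff_comm ({k} : Finset (Fin n)) {j}]
  rcases lt_or_gt_of_ne h with h | h
  · simp [sgn, h.le, not_le.2 h]
  · simp [sgn, h.le, not_le.2 h]

end Cliff

/-! ### Vectors -/

/-- The inclusion `ℝ^k ⊂ ℂ^k`. -/
def ofRealVec {k : ℕ} (x : EuclideanSpace ℝ (Fin k)) : EuclideanSpace ℂ (Fin k) :=
  WithLp.toLp 2 fun j => (x j : ℂ)

/-- The real part `ξ` of `ζ = ξ + iη ∈ ℂ^k`. -/
def reVec {k : ℕ} (ζ : EuclideanSpace ℂ (Fin k)) : EuclideanSpace ℝ (Fin k) :=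
  WithLp.toLp 2 fun j => (ζ j).re

/-- The imaginary part `η` of `ζ = ξ + iη ∈ ℂ^k`. -/
def imVec {k : ℕ} (ζ : EuclideanSpace ℂ (Fin k)) : EuclideanSpace ℝ (Fin k) :=
  WithLp.toLp 2 fun j => (ζ j).im

/-- The embedding `z ↦ (0, z)` of `ℂ^n` in `ℂ^{n+1}`. -/
def zeroCons {n : ℕ} (z : EuclideanSpace ℂ (Fin n)) : EuclideanSpace ℂ (Fin (n + 1)) :=
  WithLp.toLp 2 (Fin.cons (0 : ℂ) fun j => z j)

/-- `|ζ|_ℂ² = ζ_1² + ⋯ + ζ_k²`. -/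
def sqC {k : ℕ} (ζ : EuclideanSpace ℂ (Fin k)) : ℂ := ∑ j, ζ j ^ 2

/-- `|ζ|_ℂ`: the square root of `|ζ|_ℂ²` with positive real part when `|ζ|_ℂ² ∉ (-∞, 0]`,
and `|ζ|_ℂ = 0` when `|ζ|_ℂ² = 0`. -/
def normC {k : ℕ} (ζ : EuclideanSpace ℂ (Fin k)) : ℂ := sqC ζ ^ (1 / 2 : ℂ)

/-- The vectors `e_0 = 1, e_1, …, e_n` of the Clifford algebra. -/
def basisVec {n : ℕ} : Fin (n + 1) → Cliff n := Fin.cons 1 fun j => Cliff.e {j}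

/-- The embedding `ζ ↦ ζ_0 e_0 + ζ_1 e_1 + ⋯ + ζ_n e_n`. -/
def toCliff {n : ℕ} (ζ : EuclideanSpace ℂ (Fin (n + 1))) : Cliff n := ∑ j, ζ j • basisVec j

/-- The conjugate `ζ_0 e_0 - ζ_1 e_1 - ⋯ - ζ_n e_n`, which is complex linear in `ζ`. -/
def conjCliff {n : ℕ} (ζ : EuclideanSpace ℂ (Fin (n + 1))) : Cliff n :=
  ζ 0 • 1 - ∑ j : Fin n, ζ j.succ • Cliff.e {j}

/-! ### The Lie ball and the sets `κ(Ω)` -/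

/-- The Lie ball `L_k` in `ℂ^k`. -/
def lieBall (k : ℕ) : Set (EuclideanSpace ℂ (Fin k)) :=
  {ζ | ‖ζ‖ ^ 2 + √(‖ζ‖ ^ 4 - ‖sqC ζ‖ ^ 2) < 1}

/-- The singular set `γ_ℂ(ζ) ⊂ ℝ^{n+1}`: the `x` with `|x - ζ|_ℂ² = 0` for `n` odd, and the `x` with
`|x - ζ|_ℂ² ∈ (-∞, 0]` for `n` even. -/
def singularSet {n : ℕ} (ζ : EuclideanSpace ℂ (Fin (n + 1))) : Set (EuclideanSpace ℝ (Fin (n + 1))) :=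
  if Odd n then {x | sqC (ofRealVec x - ζ) = 0}
  else {x | (sqC (ofRealVec x - ζ)).im = 0 ∧ (sqC (ofRealVec x - ζ)).re ≤ 0}

/-- `κ(Ω)` is the set of all `ζ` with `γ_ℂ(ζ) ⊂ Ω`. -/
def kappa {n : ℕ} (Ω : Set (EuclideanSpace ℝ (Fin (n + 1)))) : Set (EuclideanSpace ℂ (Fin (n + 1))) :=
  {ζ | singularSet ζ ⊆ Ω}

/-! ### Monogenic and complex regular functions -/

/-- `D f = ∂_0 f + ∑_j e_j ∂_j f`, for functions on `𝕜^{n+1}` with `𝕜 = ℝ` or `𝕜 = ℂ`. -/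
def diracOp (𝕜 : Type*) [RCLike 𝕜] {n : ℕ} [NormedSpace 𝕜 (Cliff n)]
    (f : EuclideanSpace 𝕜 (Fin (n + 1)) → Cliff n) (x : EuclideanSpace 𝕜 (Fin (n + 1))) : Cliff n :=
  ∑ j, basisVec j * fderiv 𝕜 f x (EuclideanSpace.single j 1)

/-- The space of functions `f : U → ℂ_(n)` on an open set `U ⊂ 𝕜^{n+1}` that are continuously
differentiable over `𝕜` with `D f = 0` in `U`. (The function `F` only serves to write `f` as a
function on the whole space; its values outside `U` are irrelevant.) -/
def leftRegular (𝕜 : Type*) [RCLike 𝕜] {n : ℕ} [NormedSpace 𝕜 (Cliff n)]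
    (U : Set (EuclideanSpace 𝕜 (Fin (n + 1)))) : Set (U → Cliff n) :=
  {f | ∃ F : EuclideanSpace 𝕜 (Fin (n + 1)) → Cliff n,
    (∀ x : U, F x = f x) ∧ ContDiffOn 𝕜 1 F U ∧ ∀ x ∈ U, diracOp 𝕜 F x = 0}

/-- `M(U)`, the left monogenic functions on an open set `U ⊂ ℝ^{n+1}`. -/
def leftMonogenic {n : ℕ} (U : Set (EuclideanSpace ℝ (Fin (n + 1)))) : Set (U → Cliff n) :=
  leftRegular ℝ U

/-- `CR(U)`, the left complex regular functions on an open set `U ⊂ ℂ^{n+1}`. -/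
def complexRegular {n : ℕ} (U : Set (EuclideanSpace ℂ (Fin (n + 1)))) : Set (U → Cliff n) :=
  leftRegular ℂ U

theorem ofRealVec_mem_lieBall {k : ℕ} {x : EuclideanSpace ℝ (Fin k)} (hx : x ∈ Metric.ball 0 1) :
    ofRealVec x ∈ lieBall k := by
  have hn : ‖ofRealVec x‖ ^ 2 = ‖x‖ ^ 2 := by
    simp [EuclideanSpace.norm_sq_eq, ofRealVec]
  have hs : sqC (ofRealVec x) = ((‖x‖ ^ 2 : ℝ) : ℂ) := by
    simp [EuclideanSpace.real_norm_sq_eq, sqC, ofRealVec]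
  have h4 : ‖ofRealVec x‖ ^ 4 = (‖x‖ ^ 2) ^ 2 := by rw [← hn]; ring
  have h1 : ‖x‖ < 1 := by simpa using hx
  simp only [lieBall, Set.mem_ofPred_eq, hn, h4, hs, Complex.norm_real, Real.norm_eq_abs, sq_abs,
    sub_self, Real.sqrt_zero, add_zero]
  exact pow_lt_one₀ (norm_nonneg _) h1 two_ne_zero

/-- The restriction `v` of functions on the Lie ball `L_{n+1}` to the unit ball of `ℝ^{n+1}`. -/
def restrictReal {n : ℕ} (g : lieBall (n + 1) → Cliff n) :
    Metric.ball (0 : EuclideanSpace ℝ (Fin (n + 1))) 1 → Cliff n :=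
  fun x => g ⟨ofRealVec x.1, ofRealVec_mem_lieBall x.2⟩

/-! ### The Cauchy integral -/

/-- The volume `σ_n = 2 π^{(n+1)/2} / Γ((n+1)/2)` of the unit sphere of `ℝ^{n+1}`. -/
def sphereVol (n : ℕ) : ℝ := 2 * Real.pi ^ (((n : ℝ) + 1) / 2) / Real.Gamma (((n : ℝ) + 1) / 2)

/-- The Cauchy kernel `G_ω(ζ)`: the conjugate of `ω - ζ` divided by `σ_n |ω - ζ|_ℂ^{n+1}`. -/
def cauchyKernel {n : ℕ} (ω : EuclideanSpace ℝ (Fin (n + 1))) (ζ : EuclideanSpace ℂ (Fin (n + 1))) :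
    Cliff n :=
  ((sphereVol n : ℂ) * normC (ofRealVec ω - ζ) ^ (n + 1))⁻¹ • conjCliff (ofRealVec ω - ζ)

theorem smul_sphere_mem_ball {k : ℕ} {r : ℝ} (hr0 : 0 < r) (hr1 : r < 1)
    (ω : Metric.sphere (0 : EuclideanSpace ℝ (Fin k)) 1) :
    r • (ω : EuclideanSpace ℝ (Fin k)) ∈ Metric.ball (0 : EuclideanSpace ℝ (Fin k)) 1 := by
  simpa [norm_smul, abs_of_pos hr0] using hr1

/-- The integrand `G_{rω}(ζ) n(rω) f(rω)`, as a function of `ω` in the unit sphere `S^n`; the outward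
unit normal of the sphere `r S^n` at `rω` is `ω`. -/
def cauchyIntegrand {n : ℕ} {r : ℝ} (hr0 : 0 < r) (hr1 : r < 1)
    (f : Metric.ball (0 : EuclideanSpace ℝ (Fin (n + 1))) 1 → Cliff n)
    (ζ : EuclideanSpace ℂ (Fin (n + 1)))
    (ω : Metric.sphere (0 : EuclideanSpace ℝ (Fin (n + 1))) 1) : Cliff n :=
  cauchyKernel (r • (ω : EuclideanSpace ℝ (Fin (n + 1)))) ζ * toCliff (ofRealVec ω) *
    f ⟨r • (ω : EuclideanSpace ℝ (Fin (n + 1))), smul_sphere_mem_ball hr0 hr1 ω⟩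

/-- The surface measure of the unit sphere `S^n ⊂ ℝ^{n+1}`. -/
def surfaceMeasure (n : ℕ) :
    MeasureTheory.Measure (Metric.sphere (0 : EuclideanSpace ℝ (Fin (n + 1))) 1) :=
  (MeasureTheory.volume : MeasureTheory.Measure (EuclideanSpace ℝ (Fin (n + 1)))).toSphere

/-- The Cauchy integral of `f` over the sphere `r S^n`, whose surface measure is `r^n` times that
of `S^n` under the dilation `ω ↦ rω`. -/
def cauchyIntegral {n : ℕ} {r : ℝ} (hr0 : 0 < r) (hr1 : r < 1)
    (f : Metric.ball (0 : EuclideanSpace ℝ (Fin (n + 1))) 1 → Cliff n)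
    (ζ : EuclideanSpace ℂ (Fin (n + 1))) : Cliff n :=
  r ^ n • ∫ ω, cauchyIntegrand hr0 hr1 f ζ ω ∂(surfaceMeasure n)

end CliffordLie

end

open CliffordLie

/-!
The theorem rests on one formula. For `ζ = ξ + iη`, the largest value of `|ξ + u|²` over the vectors
`u ⟂ η` with `|u| = |η|` (equivalently, `|u| ≤ |η|`) is
`lieGauge ζ = |ξ|² + |η|² + 2 (|ξ|²|η|² - ⟨ξ, η⟩²)^(1/2)`, attained for `u` in the direction of the
component of `ξ` orthogonal to `η`. The vectors `ξ + u` are the points of the singular set of `ζ`, so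
`κ(B)` is the set where the gauge is less than `1` (`kappa_ball_eq_lieGauge_lt`); writing the gauge in
terms of `|ζ|` and `|ζ|_ℂ²` identifies this set with the Lie ball (`lieGauge_eq`). The gauge is
homogeneous of degree `2`, so the Lie ball is star-shaped, and `|ω - ζ|_ℂ²` avoids the singular values
of the kernel for `|ω| = r`, `ζ ∈ r L_{n+1}` (`sqC_sub_mem_regularValues`).

Write `E(z)` for the Cauchy kernel as a function of `z = ω - ζ`. It is holomorphic where it is regular,
and `D E = 0 = E D` there, because `z ↦ z_0 e_0 + ⋯ + z_n e_n` and its conjugate multiply to `|z|_ℂ²`.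

Cauchy's formula for a monogenic `f` on the real ball (`cauchyFormula_real`) is obtained without a
divergence theorem on the sphere. The form `E(x - y) dσ f(x)` is closed away from `y`, hence
`∫ E(x - y) ∇Φ(x) f(x) dx = 0` for each cutoff function `Φ` with compact support in the ball that
vanishes near `y`, by integration by parts on the whole space. For `Φ` equal to `∫_{|x|}^1 g` outside a
small neighborhood of `y`, the gradient of the outer part gives, in polar coordinates, the average with
weight `-g` of the Cauchy integrals over the spheres `ρ S^n`, and the gradient near `y` gives the average
of `f` against an approximate identity, times `∫ g`. Thus the Cauchy integrals, which depend
continuously on `ρ`, equal `f(y)` in the sense of distributions on `|y| < ρ < 1`, and so pointwise.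

Differentiation under the integral sign shows that the Cauchy integral over `r S^n` is complex regular
on `r L_{n+1}` (`sphereIntegral_regular`). A holomorphic function on `r L_{n+1}` that vanishes at the
real points is zero (`eq_zero_of_real_eq_zero`), by the identity theorem in one variable on the lines
`w ↦ ξ + wη`. This gives uniqueness of the extension, and it makes the Cauchy integrals for different
`r` agree where both are defined, so that together they form an extension to the Lie ball.
-/

namespace CliffordLie

noncomputable section

open MeasureTheory Metric Set Filter Topology

/-! ### The Lie ball in terms of real and imaginary parts -/

/-- The square of the Lie norm, `|ξ|² + |η|² + 2 (|ξ|²|η|² - ⟨ξ, η⟩²)^(1/2)` for `ζ = ξ + iη`. -/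
def lieGauge {k : ℕ} (ζ : EuclideanSpace ℂ (Fin k)) : ℝ :=
  ‖reVec ζ‖ ^ 2 + ‖imVec ζ‖ ^ 2 +
    2 * √(‖reVec ζ‖ ^ 2 * ‖imVec ζ‖ ^ 2 - inner ℝ (reVec ζ) (imVec ζ) ^ 2)

section Vectors

variable {k : ℕ}

@[simp] theorem reVec_apply (ζ : EuclideanSpace ℂ (Fin k)) (j : Fin k) : reVec ζ j = (ζ j).re := rfl

@[simp] theorem imVec_apply (ζ : EuclideanSpace ℂ (Fin k)) (j : Fin k) : imVec ζ j = (ζ j).im := rfl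

@[simp] theorem ofRealVec_apply (x : EuclideanSpace ℝ (Fin k)) (j : Fin k) :
    ofRealVec x j = (x j : ℂ) := rfl

/-- The inclusion `ℝ^k ⊂ ℂ^k` as a continuous real linear map. -/
def ofRealVecCLM (k : ℕ) : EuclideanSpace ℝ (Fin k) →L[ℝ] EuclideanSpace ℂ (Fin k) :=
  LinearMap.toContinuousLinearMap
    { toFun := ofRealVec
      map_add' := fun x y => by ext j; simp
      map_smul' := fun c x => by ext j; simp }

@[simp] theorem ofRealVecCLM_apply (x : EuclideanSpace ℝ (Fin k)) :
    ofRealVecCLM k x = ofRealVec x := rfl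

theorem continuous_ofRealVec : Continuous (ofRealVec (k := k)) := (ofRealVecCLM k).continuous

theorem ofRealVec_add (x y : EuclideanSpace ℝ (Fin k)) :
    ofRealVec (x + y) = ofRealVec x + ofRealVec y := (ofRealVecCLM k).map_add x y

theorem ofRealVec_sub (x y : EuclideanSpace ℝ (Fin k)) :
    ofRealVec (x - y) = ofRealVec x - ofRealVec y := (ofRealVecCLM k).map_sub x y

theorem ofRealVec_smul (r : ℝ) (x : EuclideanSpace ℝ (Fin k)) :
    ofRealVec (r • x) = r • ofRealVec x := (ofRealVecCLM k).map_smul r x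

theorem ofRealVec_single (j : Fin k) :
    ofRealVec (EuclideanSpace.single j (1 : ℝ)) = EuclideanSpace.single j (1 : ℂ) := by
  ext i
  by_cases h : i = j <;> simp [h]

theorem ofRealVec_reVec_add (ζ : EuclideanSpace ℂ (Fin k)) :
    ofRealVec (reVec ζ) + Complex.I • ofRealVec (imVec ζ) = ζ := by
  ext j
  simp [mul_comm Complex.I, Complex.re_add_im]

theorem sqC_ofRealVec (x : EuclideanSpace ℝ (Fin k)) : sqC (ofRealVec x) = ((‖x‖ ^ 2 : ℝ) : ℂ) := by
  simp [EuclideanSpace.real_norm_sq_eq, sqC]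

theorem sqC_real_smul (c : ℝ) (ζ : EuclideanSpace ℂ (Fin k)) :
    sqC (c • ζ) = ((c ^ 2 : ℝ) : ℂ) * sqC ζ := by
  simp [sqC, mul_pow, Finset.mul_sum]

theorem sqC_re (ζ : EuclideanSpace ℂ (Fin k)) : (sqC ζ).re = ‖reVec ζ‖ ^ 2 - ‖imVec ζ‖ ^ 2 := by
  rw [EuclideanSpace.real_norm_sq_eq, EuclideanSpace.real_norm_sq_eq, ← Finset.sum_sub_distrib]
  simp [sqC, pow_two]

theorem sqC_im (ζ : EuclideanSpace ℂ (Fin k)) : (sqC ζ).im = 2 * ⟪reVec ζ, imVec ζ⟫ := by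
  simp only [sqC, Complex.im_sum, PiLp.inner_apply, Finset.mul_sum]
  refine Finset.sum_congr rfl fun j _ => ?_
  simp [pow_two]
  ring

theorem norm_sq_eq_reVec_imVec (ζ : EuclideanSpace ℂ (Fin k)) :
    ‖ζ‖ ^ 2 = ‖reVec ζ‖ ^ 2 + ‖imVec ζ‖ ^ 2 := by
  rw [EuclideanSpace.norm_sq_eq, EuclideanSpace.real_norm_sq_eq, EuclideanSpace.real_norm_sq_eq,
    ← Finset.sum_add_distrib]
  refine Finset.sum_congr rfl fun j _ => ?_
  rw [Complex.sq_norm, Complex.normSq_apply]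
  simp [pow_two]

theorem gram_nonneg (x y : EuclideanSpace ℝ (Fin k)) : 0 ≤ ‖x‖ ^ 2 * ‖y‖ ^ 2 - ⟪x, y⟫ ^ 2 := by
  rw [← mul_pow, sub_nonneg, sq_le_sq, abs_mul, abs_norm, abs_norm]
  exact abs_real_inner_le_norm x y

theorem lieGauge_eq (ζ : EuclideanSpace ℂ (Fin k)) :
    lieGauge ζ = ‖ζ‖ ^ 2 + √(‖ζ‖ ^ 4 - ‖sqC ζ‖ ^ 2) := by
  have h : ‖ζ‖ ^ 4 - ‖sqC ζ‖ ^ 2 =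
      2 ^ 2 * (‖reVec ζ‖ ^ 2 * ‖imVec ζ‖ ^ 2 - ⟪reVec ζ, imVec ζ⟫ ^ 2) := by
    rw [show ‖ζ‖ ^ 4 = (‖ζ‖ ^ 2) ^ 2 by ring, norm_sq_eq_reVec_imVec, Complex.sq_norm,
      Complex.normSq_apply, sqC_re, sqC_im]
    ring
  rw [h, Real.sqrt_mul (by norm_num), Real.sqrt_sq (by norm_num), norm_sq_eq_reVec_imVec, lieGauge]

theorem lieBall_eq_lieGauge_lt : lieBall k = {ζ | lieGauge ζ < 1} := by
  ext ζ
  simp [lieBall, lieGauge_eq]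

theorem continuous_sqC : Continuous (sqC (k := k)) := by
  unfold sqC
  fun_prop

theorem continuous_lieGauge : Continuous (lieGauge (k := k)) := by
  have : lieGauge (k := k) = fun ζ => ‖ζ‖ ^ 2 + √(‖ζ‖ ^ 4 - ‖sqC ζ‖ ^ 2) := funext lieGauge_eq
  rw [this]
  have := continuous_sqC (k := k)
  fun_prop

theorem lieGauge_nonneg (ζ : EuclideanSpace ℂ (Fin k)) : 0 ≤ lieGauge ζ := by
  unfold lieGauge
  positivity

theorem lieGauge_smul (r : ℝ) (ζ : EuclideanSpace ℂ (Fin k)) :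
    lieGauge (r • ζ) = r ^ 2 * lieGauge ζ := by
  have h1 : ‖r • ζ‖ ^ 2 = r ^ 2 * ‖ζ‖ ^ 2 := by rw [norm_smul, mul_pow, Real.norm_eq_abs, sq_abs]
  have h2 : ‖sqC (r • ζ)‖ ^ 2 = (r ^ 2) ^ 2 * ‖sqC ζ‖ ^ 2 := by
    rw [sqC_real_smul, norm_mul, mul_pow, Complex.norm_real, Real.norm_eq_abs, sq_abs]
  rw [lieGauge_eq, lieGauge_eq, show ‖r • ζ‖ ^ 4 = (‖r • ζ‖ ^ 2) ^ 2 by ring, h1, h2,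
    show (r ^ 2 * ‖ζ‖ ^ 2) ^ 2 - (r ^ 2) ^ 2 * ‖sqC ζ‖ ^ 2 =
      (r ^ 2) ^ 2 * (‖ζ‖ ^ 4 - ‖sqC ζ‖ ^ 2) by ring, Real.sqrt_mul (by positivity),
    Real.sqrt_sq (by positivity)]
  ring

theorem lieGauge_ofRealVec (x : EuclideanSpace ℝ (Fin k)) : lieGauge (ofRealVec x) = ‖x‖ ^ 2 := by
  have h1 : reVec (ofRealVec x) = x := by ext j; simp
  have h2 : imVec (ofRealVec x) = 0 := by ext j; simp
  simp [lieGauge, h1, h2]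

theorem isOpen_lieBall : IsOpen (lieBall k) := by
  rw [lieBall_eq_lieGauge_lt]
  exact isOpen_lt continuous_lieGauge continuous_const

theorem isConnected_lieBall : IsConnected (lieBall k) := by
  have h0 : (0 : EuclideanSpace ℂ (Fin k)) ∈ lieBall k := by simp [lieBall, sqC]
  have hs : StarConvex ℝ (0 : EuclideanSpace ℂ (Fin k)) (lieBall k) := by
    rw [starConvex_zero_iff]
    intro ζ hζ a ha0 ha1
    rw [lieBall_eq_lieGauge_lt] at hζ ⊢
    simp only [mem_ofPred_eq, lieGauge_smul] at hζ ⊢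
    nlinarith [lieGauge_nonneg ζ, pow_le_one₀ (n := 2) ha0 ha1]
  exact (hs.isPathConnected h0).isConnected

theorem lieBall_inter_zero_section (n : ℕ) :
    lieBall (n + 1) ∩ {ζ | ζ 0 = 0} = zeroCons '' lieBall n := by
  have hn : ∀ z : EuclideanSpace ℂ (Fin n), ‖zeroCons z‖ ^ 2 = ‖z‖ ^ 2 := fun z => by
    simp [EuclideanSpace.norm_sq_eq, Fin.sum_univ_succ, zeroCons]
  have hs : ∀ z : EuclideanSpace ℂ (Fin n), sqC (zeroCons z) = sqC z := fun z => by
    simp [sqC, Fin.sum_univ_succ, zeroCons]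
  have hm : ∀ z : EuclideanSpace ℂ (Fin n), zeroCons z ∈ lieBall (n + 1) ↔ z ∈ lieBall n :=
    fun z => by
      have h4 : ∀ t : ℝ, t ^ 4 = (t ^ 2) ^ 2 := fun t => by ring
      simp only [lieBall, mem_ofPred_eq, h4, hn, hs]
  ext ζ
  constructor
  · rintro ⟨h1, h2⟩
    have : zeroCons (WithLp.toLp 2 fun j : Fin n => ζ j.succ) = ζ := by
      ext j
      refine Fin.cases ?_ (fun i => ?_) j
      · simpa [zeroCons] using h2.symm
      · simp [zeroCons]
    exact ⟨_, (hm _).1 (this ▸ h1), this⟩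
  · rintro ⟨z, hz, rfl⟩
    exact ⟨(hm z).2 hz, by simp [zeroCons]⟩

end Vectors

/-! ### The singular sets -/

/-- The values of `|z|_ℂ²` at which `|z|_ℂ^{n+1}` is holomorphic and does not vanish: all nonzero
numbers for `n` odd, and the slit plane for `n` even. -/
def regularValues (n : ℕ) : Set ℂ := if Odd n then {0}ᶜ else Complex.slitPlane

theorem isOpen_regularValues (n : ℕ) : IsOpen (regularValues n) := by
  unfold regularValues
  split_ifs
  · exact isOpen_compl_singleton
  · exact Complex.isOpen_slitPlane

theorem ne_zero_of_mem_regularValues {n : ℕ} {s : ℂ} (hs : s ∈ regularValues n) : s ≠ 0 := by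
  unfold regularValues at hs
  split_ifs at hs
  · exact hs
  · exact Complex.slitPlane_ne_zero hs

theorem ofReal_mem_regularValues {n : ℕ} {t : ℝ} (ht : 0 < t) : (t : ℂ) ∈ regularValues n := by
  unfold regularValues
  split_ifs
  · simpa using ht.ne'
  · simpa using ht

section Singular

variable {n : ℕ}

theorem mem_singularSet_iff {ζ : EuclideanSpace ℂ (Fin (n + 1))} {x : EuclideanSpace ℝ (Fin (n + 1))} :
    x ∈ singularSet ζ ↔ sqC (ofRealVec x - ζ) ∉ regularValues n := by
  unfold singularSet regularValues
  split_ifs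
  · simp
  · rw [Complex.mem_slitPlane_iff]
    simp [and_comm]

/-- A point of the singular set is `ξ + u` with `u ⟂ η` and `|u| ≤ |η|`. -/
theorem norm_sub_le_of_mem_singularSet {ζ : EuclideanSpace ℂ (Fin (n + 1))}
    {x : EuclideanSpace ℝ (Fin (n + 1))} (hx : x ∈ singularSet ζ) :
    ‖x - reVec ζ‖ ≤ ‖imVec ζ‖ ∧ ⟪x - reVec ζ, imVec ζ⟫ = 0 := by
  have h1 : reVec (ofRealVec x - ζ) = x - reVec ζ := by ext j; simp
  have h2 : imVec (ofRealVec x - ζ) = -imVec ζ := by ext j; simp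
  have h : (sqC (ofRealVec x - ζ)).im = 0 ∧ (sqC (ofRealVec x - ζ)).re ≤ 0 := by
    unfold singularSet at hx
    split_ifs at hx
    · rw [mem_ofPred_eq] at hx
      simp [hx]
    · exact hx
  rw [sqC_re, sqC_im, h1, h2, inner_neg_right, norm_neg] at h
  exact ⟨(sq_le_sq₀ (norm_nonneg _) (norm_nonneg _)).1 (by linarith [h.2]), by linarith [h.1]⟩

theorem add_mem_singularSet {ζ : EuclideanSpace ℂ (Fin (n + 1))}
    {u : EuclideanSpace ℝ (Fin (n + 1))} (hu : ‖u‖ = ‖imVec ζ‖) (h : ⟪u, imVec ζ⟫ = 0) :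
    reVec ζ + u ∈ singularSet ζ := by
  have h1 : reVec (ofRealVec (reVec ζ + u) - ζ) = u := by ext j; simp
  have h2 : imVec (ofRealVec (reVec ζ + u) - ζ) = -imVec ζ := by ext j; simp
  have h0 : sqC (ofRealVec (reVec ζ + u) - ζ) = 0 := by
    apply Complex.ext
    · rw [sqC_re, h1, h2, norm_neg, hu, sub_self, Complex.zero_re]
    · rw [sqC_im, h1, h2, inner_neg_right, h, neg_zero, mul_zero, Complex.zero_im]
  rw [mem_singularSet_iff, h0]
  exact fun h => ne_zero_of_mem_regularValues h rfl

theorem singularSet_ofRealVec (x : EuclideanSpace ℝ (Fin (n + 1))) :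
    singularSet (ofRealVec x) = {x} := by
  ext y
  rw [mem_singularSet_iff, ← ofRealVec_sub, sqC_ofRealVec, mem_singleton_iff]
  constructor
  · contrapose
    intro h
    simpa only [not_not] using ofReal_mem_regularValues
      (pow_pos (norm_pos_iff.2 (sub_ne_zero.2 h)) 2)
  · rintro rfl h
    exact ne_zero_of_mem_regularValues h (by simp)

/-- The component of `ξ` orthogonal to `η ≠ 0`; its norm times `|η|` is the area of the parallelogram
spanned by `ξ` and `η`. -/
theorem orthogonal_component_spec {k : ℕ} {ξ η : EuclideanSpace ℝ (Fin k)} (hη : η ≠ 0) :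
    ⟪ξ - (⟪ξ, η⟫ / ‖η‖ ^ 2) • η, η⟫ = 0 ∧
      ‖ξ - (⟪ξ, η⟫ / ‖η‖ ^ 2) • η‖ * ‖η‖ = √(‖ξ‖ ^ 2 * ‖η‖ ^ 2 - ⟪ξ, η⟫ ^ 2) := by
  have h0 : ‖η‖ ^ 2 ≠ 0 := pow_ne_zero 2 (norm_ne_zero_iff.2 hη)
  refine ⟨?_, ?_⟩
  · rw [inner_sub_left, real_inner_smul_left, real_inner_self_eq_norm_sq, div_mul_cancel₀ _ h0,
      sub_self]
  · rw [eq_comm, Real.sqrt_eq_iff_mul_self_eq (gram_nonneg ξ η) (by positivity), ← pow_two,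
      mul_pow, norm_sub_sq_real, real_inner_smul_right, norm_smul, mul_pow, Real.norm_eq_abs,
      sq_abs]
    field_simp
    ring

/-- If `u ⟂ η`, only the component of `ξ` orthogonal to `η` enters `⟨ξ, u⟩`; so `|ξ + u|²` is at most
the gauge when `|u| ≤ |η|`. -/
theorem norm_add_sq_le_lieGauge {k : ℕ} (ζ : EuclideanSpace ℂ (Fin k))
    {u : EuclideanSpace ℝ (Fin k)} (hu : ‖u‖ ≤ ‖imVec ζ‖) (h : ⟪u, imVec ζ⟫ = 0) :
    ‖reVec ζ + u‖ ^ 2 ≤ lieGauge ζ := by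
  by_cases hη : imVec ζ = 0
  · have : u = 0 := by simpa [hη] using hu
    simp [this, lieGauge, hη]
  obtain ⟨-, h2⟩ := orthogonal_component_spec (ξ := reVec ζ) hη
  set c := ⟪reVec ζ, imVec ζ⟫ / ‖imVec ζ‖ ^ 2
  have h3 : ⟪reVec ζ, u⟫ = ⟪reVec ζ - c • imVec ζ, u⟫ := by
    rw [inner_sub_left, real_inner_smul_left, real_inner_comm u (imVec ζ), h, mul_zero, sub_zero]
  have h4 : ⟪reVec ζ, u⟫ ≤ ‖reVec ζ - c • imVec ζ‖ * ‖imVec ζ‖ :=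
    h3 ▸ (real_inner_le_norm _ _).trans (by gcongr)
  have h5 : ‖u‖ ^ 2 ≤ ‖imVec ζ‖ ^ 2 := by gcongr
  rw [norm_add_sq_real, lieGauge, ← h2]
  linarith

/-- The bound by the gauge is attained. For `n ≥ 1` there is a direction orthogonal to `η` also when `ξ`
and `η` are parallel. -/
theorem exists_norm_add_sq_eq_lieGauge (hn : 1 ≤ n) (ζ : EuclideanSpace ℂ (Fin (n + 1))) :
    ∃ u : EuclideanSpace ℝ (Fin (n + 1)), ‖u‖ = ‖imVec ζ‖ ∧ ⟪u, imVec ζ⟫ = 0 ∧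
      ‖reVec ζ + u‖ ^ 2 = lieGauge ζ := by
  by_cases hη : imVec ζ = 0
  · exact ⟨0, by simp [hη], by simp, by simp [lieGauge, hη]⟩
  obtain ⟨h1, h2⟩ := orthogonal_component_spec (ξ := reVec ζ) hη
  set c := ⟪reVec ζ, imVec ζ⟫ / ‖imVec ζ‖ ^ 2
  set p := reVec ζ - c • imVec ζ with hp
  -- a unit vector orthogonal to `η`, in the direction of `p` if `p ≠ 0`
  obtain ⟨w, hw, hwη, hwp⟩ : ∃ w : EuclideanSpace ℝ (Fin (n + 1)),
      ‖w‖ = 1 ∧ ⟪w, imVec ζ⟫ = 0 ∧ ⟪p, w⟫ = ‖p‖ := by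
    by_cases hp0 : p = 0
    · have hd : 1 < Module.finrank ℝ (EuclideanSpace ℝ (Fin (n + 1))) := by simp; omega
      obtain ⟨v, hv0, hv⟩ : ∃ v : EuclideanSpace ℝ (Fin (n + 1)), v ≠ 0 ∧ ⟪imVec ζ, v⟫ = 0 := by
        have hlt : 0 < Module.finrank ℝ (ℝ ∙ imVec ζ)ᗮ := by
          have := (ℝ ∙ imVec ζ).finrank_add_finrank_orthogonal
          rw [finrank_span_singleton hη] at this
          omega
        have := Module.finrank_pos_iff.1 hlt
        obtain ⟨v, hv⟩ := exists_ne (0 : (ℝ ∙ imVec ζ)ᗮ)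
        exact ⟨v, by simpa using hv, Submodule.mem_orthogonal_singleton_iff_inner_right.1 v.2⟩
      refine ⟨‖v‖⁻¹ • v, ?_, ?_, ?_⟩
      · rw [norm_smul, norm_inv, norm_norm, inv_mul_cancel₀ (norm_ne_zero_iff.2 hv0)]
      · rw [real_inner_smul_left, real_inner_comm, hv, mul_zero]
      · simp [hp0]
    · refine ⟨‖p‖⁻¹ • p, ?_, ?_, ?_⟩
      · rw [norm_smul, norm_inv, norm_norm, inv_mul_cancel₀ (norm_ne_zero_iff.2 hp0)]
      · rw [real_inner_smul_left, h1, mul_zero]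
      · rw [real_inner_smul_right, real_inner_self_eq_norm_sq]
        field_simp
  refine ⟨‖imVec ζ‖ • w, by simp [norm_smul, hw], by rw [real_inner_smul_left, hwη, mul_zero], ?_⟩
  have h3 : ⟪reVec ζ, w⟫ = ‖p‖ := by
    rw [← hwp, hp, inner_sub_left, real_inner_smul_left, real_inner_comm w (imVec ζ), hwη, mul_zero, sub_zero]
  rw [norm_add_sq_real, real_inner_smul_right, h3, norm_smul, hw, norm_norm, mul_one, lieGauge,
    ← h2]
  ring

theorem kappa_ball_eq_lieGauge_lt (hn : 1 ≤ n) :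
    kappa (ball (0 : EuclideanSpace ℝ (Fin (n + 1))) 1) = {ζ | lieGauge ζ < 1} := by
  ext ζ
  constructor
  · intro h
    obtain ⟨u, hu, hu0, hN⟩ := exists_norm_add_sq_eq_lieGauge hn ζ
    have := h (add_mem_singularSet hu hu0)
    rw [mem_ball_zero_iff] at this
    rw [mem_ofPred_eq, ← hN]
    exact pow_lt_one₀ (norm_nonneg _) this two_ne_zero
  · intro h x hx
    obtain ⟨h1, h2⟩ := norm_sub_le_of_mem_singularSet hx
    have := norm_add_sq_le_lieGauge ζ h1 h2
    rw [add_sub_cancel] at this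
    rw [mem_ball_zero_iff]
    exact (sq_lt_one_iff₀ (norm_nonneg _)).1 (this.trans_lt h)

/-- The kernel `G_x` is regular on `r L_{n+1}` for `|x| = r`. -/
theorem sqC_sub_mem_regularValues {x : EuclideanSpace ℝ (Fin (n + 1))}
    {ζ : EuclideanSpace ℂ (Fin (n + 1))} (h : lieGauge ζ < ‖x‖ ^ 2) :
    sqC (ofRealVec x - ζ) ∈ regularValues n := by
  by_contra hx
  obtain ⟨h1, h2⟩ := norm_sub_le_of_mem_singularSet (mem_singularSet_iff.2 hx)
  have := norm_add_sq_le_lieGauge ζ h1 h2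
  rw [add_sub_cancel] at this
  exact absurd this (not_le.2 h)

theorem exists_mem_lieBall_smul_eq_iff {k : ℕ} {r : ℝ} (hr : 0 < r)
    {ζ : EuclideanSpace ℂ (Fin k)} :
    (∃ z ∈ lieBall k, ζ = r • z) ↔ lieGauge ζ < r ^ 2 := by
  rw [lieBall_eq_lieGauge_lt]
  constructor
  · rintro ⟨z, hz, rfl⟩
    rw [lieGauge_smul]
    nlinarith [pow_pos hr 2, show lieGauge z < 1 from hz]
  · intro h
    refine ⟨r⁻¹ • ζ, ?_, by rw [smul_inv_smul₀ hr.ne']⟩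
    rw [mem_ofPred_eq, lieGauge_smul, inv_pow, inv_mul_lt_iff₀ (by positivity), mul_one]
    exact h

end Singular

/-! ### Calculus in the Clifford algebra -/

section Algebra

variable {n : ℕ}

/-- The product of the Clifford algebra as a continuous complex bilinear map. The norm on `Cliff n` is
not submultiplicative, so this comes from finite dimensionality. -/
def mulCLM (n : ℕ) : Cliff n →L[ℂ] Cliff n →L[ℂ] Cliff n :=
  (LinearMap.mul ℂ (Cliff n)).toContinuousBilinearMap

@[simp] theorem mulCLM_apply (u v : Cliff n) : mulCLM n u v = u * v := rfl

/-- The product of the Clifford algebra as a continuous real bilinear map. -/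
def mulCLMReal (n : ℕ) : Cliff n →L[ℝ] Cliff n →L[ℝ] Cliff n :=
  (mulCLM n).bilinearRestrictScalars ℝ

@[simp] theorem mulCLMReal_apply (u v : Cliff n) : mulCLMReal n u v = u * v := rfl

instance : ContinuousMul (Cliff n) := ⟨(mulCLMReal n).isBoundedBilinearMap.continuous⟩

/-- The conjugates `ē_0 = 1`, `ē_j = -e_j` of the basis vectors. -/
def conjBasisVec : Fin (n + 1) → Cliff n := Fin.cons 1 fun j => -Cliff.e {j}

theorem conjCliff_eq_sum (ζ : EuclideanSpace ℂ (Fin (n + 1))) :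
    conjCliff ζ = ∑ j, ζ j • conjBasisVec j := by
  simp [conjCliff, conjBasisVec, Fin.sum_univ_succ, sub_eq_add_neg]

theorem basisVec_mul_conjBasisVec_add (j k : Fin (n + 1)) :
    (basisVec j * conjBasisVec k + basisVec k * conjBasisVec j : Cliff n) =
      if j = k then 2 else 0 := by
  refine Fin.cases ?_ (fun a => ?_) j <;> refine Fin.cases ?_ (fun b => ?_) k
  · simp [basisVec, conjBasisVec, one_add_one_eq_two]
  · simp [basisVec, conjBasisVec, (Fin.succ_ne_zero b).symm]
  · simp [basisVec, conjBasisVec, Fin.succ_ne_zero a]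
  · by_cases h : a = b
    · subst h
      simp [basisVec, conjBasisVec, Cliff.e_mul_self, one_add_one_eq_two]
    · simp [basisVec, conjBasisVec, h, Cliff.e_mul_e_anticomm a b h]

theorem conjBasisVec_mul_basisVec_add (j k : Fin (n + 1)) :
    (conjBasisVec j * basisVec k + conjBasisVec k * basisVec j : Cliff n) =
      if j = k then 2 else 0 := by
  refine Fin.cases ?_ (fun a => ?_) j <;> refine Fin.cases ?_ (fun b => ?_) k
  · simp [basisVec, conjBasisVec, one_add_one_eq_two]
  · simp [basisVec, conjBasisVec, (Fin.succ_ne_zero b).symm]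
  · simp [basisVec, conjBasisVec, Fin.succ_ne_zero a]
  · by_cases h : a = b
    · subst h
      simp [basisVec, conjBasisVec, Cliff.e_mul_self, one_add_one_eq_two]
    · simp [basisVec, conjBasisVec, h, Cliff.e_mul_e_anticomm a b h]

/-- A quadratic form over `ℂ` in the Clifford algebra, computed from its symmetrization. -/
theorem sum_smul_mul_sum_smul (ζ : EuclideanSpace ℂ (Fin (n + 1))) (b c : Fin (n + 1) → Cliff n)
    (h : ∀ j k, b j * c k + b k * c j = if j = k then 2 else 0) :
    (∑ j, ζ j • b j) * ∑ j, ζ j • c j = sqC ζ • 1 := by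
  have h1 : (∑ j, ζ j • b j) * ∑ j, ζ j • c j = ∑ j, ∑ k, (ζ j * ζ k) • (b j * c k) := by
    simp only [Finset.sum_mul_sum, smul_mul_smul_comm]
  have h2 : ∑ j, ∑ k, (ζ j * ζ k) • (b j * c k) = ∑ j, ∑ k, (ζ j * ζ k) • (b k * c j) := by
    rw [Finset.sum_comm]
    simp only [mul_comm]
  have h3 : (2 : ℂ) • ((∑ j, ζ j • b j) * ∑ j, ζ j • c j) = (2 : ℂ) • (sqC ζ • (1 : Cliff n)) := by
    rw [two_smul]
    nth_rewrite 2 [h1]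
    rw [h2, h1]
    simp only [← Finset.sum_add_distrib, ← smul_add, h]
    simp only [smul_ite, smul_zero, Finset.sum_ite_eq, Finset.mem_univ, if_true]
    rw [← Finset.sum_smul, smul_smul, mul_comm, ← smul_smul, sqC, two_smul ℂ (1 : Cliff n),
      one_add_one_eq_two]
    simp only [pow_two]
  exact smul_right_injective _ (two_ne_zero (α := ℂ)) h3

theorem toCliff_mul_conjCliff (ζ : EuclideanSpace ℂ (Fin (n + 1))) :
    toCliff ζ * conjCliff ζ = sqC ζ • 1 := by
  rw [conjCliff_eq_sum]
  exact sum_smul_mul_sum_smul ζ _ _ basisVec_mul_conjBasisVec_add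

theorem conjCliff_mul_toCliff (ζ : EuclideanSpace ℂ (Fin (n + 1))) :
    conjCliff ζ * toCliff ζ = sqC ζ • 1 := by
  rw [conjCliff_eq_sum]
  exact sum_smul_mul_sum_smul ζ _ _ conjBasisVec_mul_basisVec_add

theorem basisVec_mul_conjBasisVec (j : Fin (n + 1)) : (basisVec j * conjBasisVec j : Cliff n) = 1 := by
  refine Fin.cases ?_ (fun a => ?_) j <;> simp [basisVec, conjBasisVec, Cliff.e_mul_self]

theorem conjBasisVec_mul_basisVec (j : Fin (n + 1)) : (conjBasisVec j * basisVec j : Cliff n) = 1 := by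
  refine Fin.cases ?_ (fun a => ?_) j <;> simp [basisVec, conjBasisVec, Cliff.e_mul_self]

/-- Conjugation `ζ ↦ ζ_0 - ∑ ζ_j e_j` as a continuous complex linear map. -/
def conjCliffCLM (n : ℕ) : EuclideanSpace ℂ (Fin (n + 1)) →L[ℂ] Cliff n :=
  LinearMap.toContinuousLinearMap
    { toFun := conjCliff
      map_add' := fun x y => by simp [conjCliff_eq_sum, add_smul, Finset.sum_add_distrib]
      map_smul' := fun c x => by simp [conjCliff_eq_sum, Finset.smul_sum, smul_smul] }

@[simp] theorem conjCliffCLM_apply (ζ : EuclideanSpace ℂ (Fin (n + 1))) :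
    conjCliffCLM n ζ = conjCliff ζ := rfl

/-- The embedding `ζ ↦ ∑ ζ_j e_j` as a continuous complex linear map. -/
def toCliffCLM (n : ℕ) : EuclideanSpace ℂ (Fin (n + 1)) →L[ℂ] Cliff n :=
  LinearMap.toContinuousLinearMap
    { toFun := toCliff
      map_add' := fun x y => by simp [toCliff, add_smul, Finset.sum_add_distrib]
      map_smul' := fun c x => by simp [toCliff, Finset.smul_sum, smul_smul] }

@[simp] theorem toCliffCLM_apply (ζ : EuclideanSpace ℂ (Fin (n + 1))) :
    toCliffCLM n ζ = toCliff ζ := rfl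

theorem continuous_toCliff : Continuous (toCliff (n := n)) := (toCliffCLM n).continuous

theorem conjCliff_single (j : Fin (n + 1)) :
    conjCliff (EuclideanSpace.single j (1 : ℂ)) = (conjBasisVec j : Cliff n) := by
  simp [conjCliff_eq_sum, Finset.sum_ite_eq', ite_smul]

theorem toCliff_real_smul (c : ℝ) (ζ : EuclideanSpace ℂ (Fin (n + 1))) :
    toCliff (c • ζ) = c • toCliff ζ := (toCliffCLM n).map_smul_of_tower c ζ

end Algebra

/-! ### The Cauchy kernel -/

section Kernel

variable {n : ℕ}

theorem sphereVol_pos (n : ℕ) : 0 < sphereVol n := by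
  unfold sphereVol
  have := Real.Gamma_pos_of_pos (show (0 : ℝ) < ((n : ℝ) + 1) / 2 by positivity)
  positivity

/-- The scalar factor `1 / (σ_n s^{(n+1)/2})` of the Cauchy kernel as a function of `s = |z|_ℂ²`. -/
def kernelScalar (n : ℕ) (s : ℂ) : ℂ := ((sphereVol n : ℂ) * (s ^ (1 / 2 : ℂ)) ^ (n + 1))⁻¹

/-- The Cauchy kernel as a function `E` of the difference: `G_ω(ζ) = E(ω - ζ)`. -/
def cauchyKernelDiff (z : EuclideanSpace ℂ (Fin (n + 1))) : Cliff n :=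
  kernelScalar n (sqC z) • conjCliff z

theorem cauchyKernel_eq (ω : EuclideanSpace ℝ (Fin (n + 1))) (ζ : EuclideanSpace ℂ (Fin (n + 1))) :
    cauchyKernel ω ζ = cauchyKernelDiff (ofRealVec ω - ζ) := rfl

theorem hasDerivAt_kernelScalar {s : ℂ} (hs : s ∈ regularValues n) :
    HasDerivAt (kernelScalar n) (-((n + 1 : ℂ) / 2) * kernelScalar n s / s) s := by
  have hs0 : s ≠ 0 := ne_zero_of_mem_regularValues hs
  have hσ : (sphereVol n : ℂ) ≠ 0 := by exact_mod_cast (sphereVol_pos n).ne'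
  have hq0 : (s ^ (1 / 2 : ℂ)) ^ (n + 1) ≠ 0 :=
    pow_ne_zero _ (by simp [Complex.cpow_eq_zero_iff, hs0])
  have hq : HasDerivAt (fun s : ℂ => (s ^ (1 / 2 : ℂ)) ^ (n + 1))
      (((n + 1 : ℂ) / 2) * (s ^ (1 / 2 : ℂ)) ^ (n + 1) / s) s := by
    unfold regularValues at hs
    split_ifs at hs with hn
    · -- for `n` odd the power is a polynomial in `s`
      obtain ⟨m, rfl⟩ := hn
      have h2 : ∀ t : ℂ, (t ^ (1 / 2 : ℂ)) ^ (2 * m + 1 + 1) = t ^ (m + 1) := fun t => by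
        rw [show 2 * m + 1 + 1 = 2 * (m + 1) by ring, pow_mul, one_div]
        congr 1
        exact Complex.cpow_nat_inv_pow t two_ne_zero
      simp only [h2]
      refine (hasDerivAt_pow (m + 1) s).congr_deriv ?_
      rw [Nat.add_sub_cancel, pow_succ]
      field_simp
      push_cast
      ring
    · have := ((hasDerivAt_id s).cpow_const (c := (1 / 2 : ℂ)) hs).pow (n + 1)
      refine this.congr_deriv ?_
      rw [Nat.add_sub_cancel, id_eq, Complex.cpow_sub _ _ hs0, Complex.cpow_one, pow_succ]
      push_cast
      ring
  have := (hq.const_mul (sphereVol n : ℂ)).inv (mul_ne_zero hσ hq0)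
  refine this.congr_deriv ?_
  unfold kernelScalar
  field_simp

theorem hasFDerivAt_sqC {k : ℕ} (z : EuclideanSpace ℂ (Fin k)) :
    HasFDerivAt sqC (∑ j, (2 * z j) • (EuclideanSpace.proj j : EuclideanSpace ℂ (Fin k) →L[ℂ] ℂ)) z := by
  unfold sqC
  refine HasFDerivAt.fun_sum fun j _ => ?_
  have := ((EuclideanSpace.proj j : EuclideanSpace ℂ (Fin k) →L[ℂ] ℂ).hasFDerivAt (x := z)).pow 2
  simpa using this

/-- The complex derivative of the kernel `E` at `z`. -/
def cauchyKernelDeriv (z : EuclideanSpace ℂ (Fin (n + 1))) :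
    EuclideanSpace ℂ (Fin (n + 1)) →L[ℂ] Cliff n :=
  kernelScalar n (sqC z) • conjCliffCLM n +
    ((-((n + 1 : ℂ) / 2) * kernelScalar n (sqC z) / sqC z) •
      ∑ j, (2 * z j) • (EuclideanSpace.proj j : EuclideanSpace ℂ (Fin (n + 1)) →L[ℂ] ℂ)).smulRight
        (conjCliff z)

theorem hasFDerivAt_cauchyKernelDiff {z : EuclideanSpace ℂ (Fin (n + 1))}
    (hz : sqC z ∈ regularValues n) :
    HasFDerivAt cauchyKernelDiff (cauchyKernelDeriv z) z :=
  ((hasDerivAt_kernelScalar hz).comp_hasFDerivAt z (hasFDerivAt_sqC z)).smul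
    ((conjCliffCLM n).hasFDerivAt)

theorem isOpen_sqC_mem_regularValues :
    IsOpen {z : EuclideanSpace ℂ (Fin (n + 1)) | sqC z ∈ regularValues n} :=
  (isOpen_regularValues n).preimage continuous_sqC

theorem contDiffOn_cauchyKernelDiff :
    ContDiffOn ℂ 1 (cauchyKernelDiff (n := n)) {z | sqC z ∈ regularValues n} := by
  have h1 : ContDiffOn ℂ 1 (kernelScalar n) (regularValues n) :=
    DifferentiableOn.contDiffOn
      (fun s hs => (hasDerivAt_kernelScalar hs).differentiableAt.differentiableWithinAt)
      (isOpen_regularValues n)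
  have h2 : ContDiff ℂ 1 (sqC (k := n + 1)) := by
    unfold sqC
    fun_prop
  exact (h1.comp h2.contDiffOn fun z hz => hz).smul (conjCliffCLM n).contDiff.contDiffOn

theorem cauchyKernelDeriv_single (z : EuclideanSpace ℂ (Fin (n + 1))) (j : Fin (n + 1)) :
    cauchyKernelDeriv z (EuclideanSpace.single j 1) = kernelScalar n (sqC z) • conjBasisVec j -
      (((n + 1 : ℂ) * kernelScalar n (sqC z) / sqC z) * z j) • conjCliff z := by
  simp only [cauchyKernelDeriv, add_apply, smul_apply,
    conjCliffCLM_apply, conjCliff_single, ContinuousLinearMap.smulRight_apply, sub_eq_add_neg,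
    ← neg_smul, sum_apply]
  congr 2
  simp
  ring

/-- The kernel is left regular as a function of the difference, `D E = 0`. -/
theorem sum_basisVec_mul_cauchyKernelDeriv {z : EuclideanSpace ℂ (Fin (n + 1))}
    (hz : sqC z ≠ 0) :
    ∑ j, basisVec j * cauchyKernelDeriv z (EuclideanSpace.single j 1) = 0 := by
  simp only [cauchyKernelDeriv_single, mul_sub, Finset.sum_sub_distrib, mul_smul_comm,
    basisVec_mul_conjBasisVec]
  have h : ∑ j, (((n + 1 : ℂ) * kernelScalar n (sqC z) / sqC z) * z j) • (basisVec j * conjCliff z) =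
      ((n + 1 : ℂ) * kernelScalar n (sqC z) / sqC z) • (toCliff z * conjCliff z) := by
    simp only [toCliff, Finset.sum_mul, Finset.smul_sum, smul_mul_assoc, smul_smul]
  rw [h, toCliff_mul_conjCliff, smul_smul, div_mul_cancel₀ _ hz, Finset.sum_const, Finset.card_univ,
    Fintype.card_fin, mul_smul, sub_eq_zero, ← Nat.cast_smul_eq_nsmul ℂ]
  push_cast
  rfl

/-- The kernel is right regular as a function of the difference, `E D = 0`. -/
theorem sum_cauchyKernelDeriv_mul_basisVec {z : EuclideanSpace ℂ (Fin (n + 1))}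
    (hz : sqC z ≠ 0) :
    ∑ j, cauchyKernelDeriv z (EuclideanSpace.single j 1) * basisVec j = 0 := by
  simp only [cauchyKernelDeriv_single, sub_mul, Finset.sum_sub_distrib, smul_mul_assoc,
    conjBasisVec_mul_basisVec]
  have h : ∑ j, (((n + 1 : ℂ) * kernelScalar n (sqC z) / sqC z) * z j) • (conjCliff z * basisVec j) =
      ((n + 1 : ℂ) * kernelScalar n (sqC z) / sqC z) • (conjCliff z * toCliff z) := by
    simp only [toCliff, Finset.mul_sum, Finset.smul_sum, mul_smul_comm, smul_smul]
  rw [h, conjCliff_mul_toCliff, smul_smul, div_mul_cancel₀ _ hz, Finset.sum_const, Finset.card_univ,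
    Fintype.card_fin, mul_smul, sub_eq_zero, ← Nat.cast_smul_eq_nsmul ℂ]
  push_cast
  rfl

/-- On `ℝ^{n+1}`, `E(x) x = 1 / (σ_n |x|^{n-1})`. -/
theorem cauchyKernelDiff_ofRealVec_mul_toCliff (x : EuclideanSpace ℝ (Fin (n + 1))) :
    cauchyKernelDiff (ofRealVec x) * toCliff (ofRealVec x) =
      ((sphereVol n * ‖x‖ ^ (n + 1))⁻¹ * ‖x‖ ^ 2) • (1 : Cliff n) := by
  have h : ((‖x‖ ^ 2 : ℝ) : ℂ) ^ (1 / 2 : ℂ) = (‖x‖ : ℂ) := by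
    rw [show (1 / 2 : ℂ) = ((1 / 2 : ℝ) : ℂ) by push_cast; rfl,
      ← Complex.ofReal_cpow (by positivity), ← Real.sqrt_eq_rpow, Real.sqrt_sq (norm_nonneg x)]
  rw [cauchyKernelDiff, smul_mul_assoc, conjCliff_mul_toCliff, smul_smul, sqC_ofRealVec,
    kernelScalar, h, ← Complex.coe_smul]
  push_cast
  rfl

end Kernel

/-! ### Integration by parts against the Cauchy kernel -/

theorem integral_fderiv_apply_eq_zero {E V : Type*} [NormedAddCommGroup E] [NormedSpace ℝ E]
    [FiniteDimensional ℝ E] [MeasurableSpace E] [BorelSpace E] {μ : Measure E} [μ.IsAddHaarMeasure]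
    [NormedAddCommGroup V] [NormedSpace ℝ V] {h : E → V} (hh : ContDiff ℝ 1 h)
    (hc : HasCompactSupport h) (v : E) :
    Integrable (fun x => fderiv ℝ h x v) μ ∧ ∫ x, fderiv ℝ h x v ∂μ = 0 := by
  have hd : Continuous fun x => fderiv ℝ h x v :=
    (hh.continuous_fderiv one_ne_zero).clm_apply continuous_const
  have hi : Integrable (fun x => fderiv ℝ h x v) μ :=
    hd.integrable_of_hasCompactSupport (hc.fderiv_apply ℝ v)
  refine ⟨hi, ?_⟩
  have := integral_smul_fderiv_eq_neg_fderiv_smul_of_integrable (μ := μ) (f := fun _ : E => (1 : ℝ))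
    (g := h) (v := v) (by simp) (by simpa using hi)
    (by simpa using hh.continuous.integrable_of_hasCompactSupport hc) (fun x _ => by fun_prop)
    (fun x _ => hh.differentiable one_ne_zero x)
  simpa using this

/-- Integration in polar coordinates. -/
theorem integral_eq_integral_Ioi_sphere {E V : Type*} [NormedAddCommGroup E] [NormedSpace ℝ E]
    [Nontrivial E] [FiniteDimensional ℝ E] [MeasurableSpace E] [BorelSpace E] {μ : Measure E}
    [μ.IsAddHaarMeasure] [NormedAddCommGroup V] [NormedSpace ℝ V] {F : E → V}
    (hF : Integrable F μ) :
    ∫ x, F x ∂μ = ∫ ρ in Ioi (0 : ℝ), ρ ^ (Module.finrank ℝ E - 1) •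
      ∫ ω : sphere (0 : E) 1, F (ρ • (ω : E)) ∂μ.toSphere := by
  set m := Module.finrank ℝ E - 1
  have hmp := μ.measurePreserving_homeomorphUnitSphereProd
  have hemb := (homeomorphUnitSphereProd E).measurableEmbedding
  set Q : sphere (0 : E) 1 × Ioi (0 : ℝ) → V := fun p => F ((p.2 : ℝ) • (p.1 : E)) with hQ
  have hQF : ∀ x : ({0}ᶜ : Set E), Q (homeomorphUnitSphereProd E x) = F x := fun x => by
    have hx : ‖(x : E)‖ ≠ 0 := norm_ne_zero_iff.2 x.2
    simp [hQ, smul_smul, hx]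
  have hi : Integrable Q (μ.toSphere.prod (Measure.volumeIoiPow m)) := by
    rw [← hmp.integrable_comp_emb hemb]
    have : (Q ∘ homeomorphUnitSphereProd E) = fun x : ({0}ᶜ : Set E) => F x := funext hQF
    rw [this]
    exact (integrableOn_iff_comap_subtypeVal (measurableSet_singleton _).compl).1 hF.integrableOn
  calc
    ∫ x, F x ∂μ = ∫ x : ({0}ᶜ : Set E), F x ∂(μ.comap (↑)) := by
      rw [integral_subtype_comap (measurableSet_singleton _).compl F, restrict_compl_singleton]
    _ = ∫ p, Q p ∂(μ.toSphere.prod (Measure.volumeIoiPow m)) := by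
      rw [← hmp.integral_comp hemb]
      exact integral_congr_ae (.of_forall fun x => (hQF x).symm)
    _ = ∫ ρ : Ioi (0 : ℝ), ∫ ω, F ((ρ : ℝ) • (ω : E)) ∂μ.toSphere ∂(Measure.volumeIoiPow m) :=
      integral_prod_symm _ hi
    _ = _ := by
      simp only [Measure.volumeIoiPow, ENNReal.ofReal]
      rw [integral_withDensity_eq_integral_smul,
        integral_subtype_comap measurableSet_Ioi fun a : ℝ => Real.toNNReal (a ^ m) •
          ∫ ω : sphere (0 : E) 1, F (a • (ω : E)) ∂μ.toSphere,
        setIntegral_congr_fun measurableSet_Ioi fun x hx => ?_]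
      · simp only [NNReal.smul_def, Real.coe_toNNReal _ (pow_nonneg (mem_Ioi.1 hx).le _)]
      · exact (measurable_subtype_coe.pow_const _).real_toNNReal

section Stokes

variable {n : ℕ}

theorem sqC_ofRealVec_mem_regularValues {x : EuclideanSpace ℝ (Fin (n + 1))} (hx : x ≠ 0) :
    sqC (ofRealVec x) ∈ regularValues n := by
  rw [sqC_ofRealVec]
  exact ofReal_mem_regularValues (pow_pos (norm_pos_iff.2 hx) 2)

theorem hasFDerivAt_cauchyKernelDiff_ofRealVec {x y : EuclideanSpace ℝ (Fin (n + 1))}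
    (hx : x ≠ y) :
    HasFDerivAt (fun x => cauchyKernelDiff (ofRealVec (x - y)))
      (((cauchyKernelDeriv (ofRealVec (x - y))).restrictScalars ℝ).comp (ofRealVecCLM (n + 1))) x := by
  have h1 := (hasFDerivAt_cauchyKernelDiff
    (sqC_ofRealVec_mem_regularValues (sub_ne_zero.2 hx))).restrictScalars ℝ
  have h2 : HasFDerivAt (fun x => ofRealVec (x - y)) (ofRealVecCLM (n + 1)) x :=
    (ofRealVecCLM (n + 1)).hasFDerivAt.comp x ((hasFDerivAt_id x).sub_const y)
  exact h1.comp x h2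

theorem contDiffOn_cauchyKernelDiff_ofRealVec (y : EuclideanSpace ℝ (Fin (n + 1))) :
    ContDiffOn ℝ 1 (fun x => cauchyKernelDiff (ofRealVec (x - y))) {y}ᶜ := by
  refine (contDiffOn_cauchyKernelDiff.restrict_scalars ℝ).comp
    (g := cauchyKernelDiff) (f := fun x => ofRealVec (x - y)) (ContDiff.contDiffOn ?_) ?_
  · exact (ofRealVecCLM (n + 1)).contDiff.comp (contDiff_id.sub contDiff_const)
  · intro x hx
    exact sqC_ofRealVec_mem_regularValues (sub_ne_zero.2 hx)

/-- The derivative of one component of the form `Φ(x) E(x - y) dσ f(x)`. -/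
theorem fderiv_smul_cauchyKernel_mul_apply {f : EuclideanSpace ℝ (Fin (n + 1)) → Cliff n}
    {x y : EuclideanSpace ℝ (Fin (n + 1))} (hf : DifferentiableAt ℝ f x) (hxy : x ≠ y)
    {Φ : EuclideanSpace ℝ (Fin (n + 1)) → ℝ} {G : EuclideanSpace ℝ (Fin (n + 1))}
    (hG : HasGradientAt Φ G x) (j : Fin (n + 1)) :
    fderiv ℝ (fun x => Φ x • (cauchyKernelDiff (ofRealVec (x - y)) * (basisVec j * f x))) x
        (EuclideanSpace.single j 1) =
      G j • (cauchyKernelDiff (ofRealVec (x - y)) * (basisVec j * f x)) +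
        Φ x • (cauchyKernelDiff (ofRealVec (x - y)) *
            (basisVec j * fderiv ℝ f x (EuclideanSpace.single j 1)) +
          cauchyKernelDeriv (ofRealVec (x - y)) (EuclideanSpace.single j 1) *
            basisVec j * f x) := by
  have h1 : HasFDerivAt (fun x => basisVec j * f x)
      ((mulCLMReal n (basisVec j)).comp (fderiv ℝ f x)) x :=
    (mulCLMReal n (basisVec j)).hasFDerivAt.comp x hf.hasFDerivAt
  have h2 := (mulCLMReal n).hasFDerivAt_of_bilinear
    (hasFDerivAt_cauchyKernelDiff_ofRealVec hxy) h1
  have h3 := (hG.hasFDerivAt.smul h2).fderiv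
  simp only [mulCLMReal_apply] at h3
  refine (congrArg (fun L => L (EuclideanSpace.single j 1)) h3).trans ?_
  simp only [add_apply, smul_apply, ContinuousLinearMap.smulRight_apply,
    InnerProductSpace.toDual_apply_apply, EuclideanSpace.inner_single_right,
    ContinuousLinearMap.precompR_apply, ContinuousLinearMap.precompL_apply,
    ContinuousLinearMap.compL_apply, ContinuousLinearMap.comp_apply, ContinuousLinearMap.coe_restrictScalars', mulCLMReal_apply,
    ofRealVecCLM_apply, ofRealVec_single, one_mul, conj_trivial, mul_assoc]
  rw [add_comm]

theorem contDiffAt_cliff_mul {H : Type*} [NormedAddCommGroup H] [NormedSpace ℝ H]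
    {f g : H → Cliff n} {x : H} (hf : ContDiffAt ℝ 1 f x) (hg : ContDiffAt ℝ 1 g x) :
    ContDiffAt ℝ 1 (fun x => f x * g x) x := by
  have h1 : ContDiffAt ℝ 1 (fun x => mulCLMReal n (f x)) x :=
    (mulCLMReal n).contDiff.contDiffAt.comp x hf
  exact h1.clm_apply hg

theorem contDiffAt_smul_cauchyKernel_mul {f : EuclideanSpace ℝ (Fin (n + 1)) → Cliff n}
    {x y : EuclideanSpace ℝ (Fin (n + 1))} (hf : ContDiffAt ℝ 1 f x) (hxy : x ≠ y)
    {Φ : EuclideanSpace ℝ (Fin (n + 1)) → ℝ} (hΦ : ContDiffAt ℝ 1 Φ x) (u : Cliff n) :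
    ContDiffAt ℝ 1
      (fun x => Φ x • (cauchyKernelDiff (ofRealVec (x - y)) * (u * f x))) x := by
  have h2 : ContDiffAt ℝ 1 (fun x => cauchyKernelDiff (ofRealVec (x - y))) x :=
    (contDiffOn_cauchyKernelDiff_ofRealVec y).contDiffAt (isOpen_compl_singleton.mem_nhds hxy)
  exact hΦ.smul (contDiffAt_cliff_mul h2 (contDiffAt_cliff_mul contDiffAt_const hf))

/-- The form `E(x - y) dσ f(x)` is closed, since `E D = 0` and `D f = 0`. -/
theorem sum_fderiv_smul_cauchyKernel_mul {f : EuclideanSpace ℝ (Fin (n + 1)) → Cliff n}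
    {x y : EuclideanSpace ℝ (Fin (n + 1))} (hf : DifferentiableAt ℝ f x) (hD : diracOp ℝ f x = 0)
    (hxy : x ≠ y) {Φ : EuclideanSpace ℝ (Fin (n + 1)) → ℝ} {G : EuclideanSpace ℝ (Fin (n + 1))}
    (hG : HasGradientAt Φ G x) :
    ∑ j, fderiv ℝ (fun x => Φ x • (cauchyKernelDiff (ofRealVec (x - y)) * (basisVec j * f x))) x
        (EuclideanSpace.single j 1) =
      cauchyKernelDiff (ofRealVec (x - y)) * toCliff (ofRealVec G) * f x := by
  have hz : sqC (ofRealVec (x - y)) ≠ 0 :=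
    ne_zero_of_mem_regularValues (sqC_ofRealVec_mem_regularValues (sub_ne_zero.2 hxy))
  have hD' : ∑ j, basisVec j * fderiv ℝ f x (EuclideanSpace.single j 1) = 0 := hD
  simp only [fderiv_smul_cauchyKernel_mul_apply hf hxy hG, Finset.sum_add_distrib,
    ← Finset.smul_sum, ← Finset.mul_sum, ← Finset.sum_mul]
  rw [hD', sum_cauchyKernelDeriv_mul_basisVec hz, zero_mul, mul_zero, add_zero, smul_zero,
    add_zero, mul_assoc, toCliff, Finset.sum_mul, Finset.mul_sum]
  refine Finset.sum_congr rfl fun j _ => ?_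
  rw [smul_mul_assoc, mul_smul_comm, ofRealVec_apply, Complex.coe_smul]

/-- Stokes' theorem in weak form: the closed form `E(x - y) dσ f(x)` integrates to zero against the
gradient of a cutoff function `Φ` that vanishes near the singularity `y`. -/
theorem integral_cauchyKernel_mul_gradient_mul {U : Set (EuclideanSpace ℝ (Fin (n + 1)))}
    (hU : IsOpen U) {f : EuclideanSpace ℝ (Fin (n + 1)) → Cliff n} (hf : ContDiffOn ℝ 1 f U)
    (hD : ∀ x ∈ U, diracOp ℝ f x = 0) {y : EuclideanSpace ℝ (Fin (n + 1))}
    {Φ : EuclideanSpace ℝ (Fin (n + 1)) → ℝ}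
    {G : EuclideanSpace ℝ (Fin (n + 1)) → EuclideanSpace ℝ (Fin (n + 1))}
    (hΦ : ContDiff ℝ 1 Φ) (hc : HasCompactSupport Φ) (hG : ∀ x, HasGradientAt Φ (G x) x)
    (hs : tsupport Φ ⊆ U \ {y}) :
    ∫ x, cauchyKernelDiff (ofRealVec (x - y)) * toCliff (ofRealVec (G x)) * f x = 0 := by
  set h : Fin (n + 1) → EuclideanSpace ℝ (Fin (n + 1)) → Cliff n :=
    fun j x => Φ x • (cauchyKernelDiff (ofRealVec (x - y)) * (basisVec j * f x)) with hh
  have hts : ∀ j, tsupport (h j) ⊆ tsupport Φ := fun j => tsupport_smul_subset_left Φ _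
  have hhc : ∀ j, HasCompactSupport (h j) := fun j => hc.smul_right
  have hhd : ∀ j, ContDiff ℝ 1 (h j) := fun j => by
    refine contDiff_iff_contDiffAt.2 fun x => ?_
    by_cases hx : x ∈ tsupport (h j)
    · obtain ⟨hxU, hxy⟩ := hs (hts j hx)
      exact contDiffAt_smul_cauchyKernel_mul (hf.contDiffAt (hU.mem_nhds hxU)) hxy hΦ.contDiffAt _
    · exact contDiffAt_const.congr_of_eventuallyEq (notMem_tsupport_iff_eventuallyEq.1 hx)
  have hsum : ∀ x, cauchyKernelDiff (ofRealVec (x - y)) * toCliff (ofRealVec (G x)) * f x =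
      ∑ j, fderiv ℝ (h j) x (EuclideanSpace.single j 1) := fun x => by
    by_cases hx : x ∈ tsupport Φ
    · obtain ⟨hxU, hxy⟩ := hs hx
      exact (sum_fderiv_smul_cauchyKernel_mul
        ((hf.contDiffAt (hU.mem_nhds hxU)).differentiableAt one_ne_zero) (hD x hxU) hxy (hG x)).symm
    · have h0 : Φ =ᶠ[𝓝 x] fun _ => 0 := notMem_tsupport_iff_eventuallyEq.1 hx
      have hG0 : G x = 0 :=
        (hG x).unique ((hasGradientAt_const x (0 : ℝ)).congr_of_eventuallyEq h0)
      have hj : ∀ j, fderiv ℝ (h j) x = 0 := fun j => by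
        have : h j =ᶠ[𝓝 x] fun _ => 0 := h0.mono fun z hz => by simp [hh, hz]
        rw [this.fderiv_eq]
        simp
      have h00 : ofRealVec (0 : EuclideanSpace ℝ (Fin (n + 1))) = 0 := (ofRealVecCLM (n + 1)).map_zero
      have h01 : toCliff (0 : EuclideanSpace ℂ (Fin (n + 1))) = 0 := (toCliffCLM n).map_zero
      simp only [hj, hG0, h00, h01, mul_zero, zero_mul, zero_apply, Finset.sum_const_zero]
  rw [integral_congr_ae (.of_forall hsum), integral_finsetSum _ fun j _ =>
    (integral_fderiv_apply_eq_zero (hhd j) (hhc j) _).1]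
  exact Finset.sum_eq_zero fun j _ => (integral_fderiv_apply_eq_zero (hhd j) (hhc j) _).2

end Stokes

/-! ### Cutoff functions -/

theorem integrable_smul_of_tsupport_subset {E V : Type*} [NormedAddCommGroup E] [MeasurableSpace E]
    [BorelSpace E] {μ : Measure E} [IsFiniteMeasureOnCompacts μ]
    [NormedAddCommGroup V] [NormedSpace ℝ V] {U : Set E} (hU : IsOpen U) {θ : E → ℝ} {H : E → V}
    (hθ : Continuous θ) (hc : HasCompactSupport θ) (hs : tsupport θ ⊆ U) (hH : ContinuousOn H U) :
    Integrable (fun x => θ x • H x) μ := by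
  refine Continuous.integrable_of_hasCompactSupport ?_ hc.smul_right
  refine continuous_iff_continuousAt.2 fun x => ?_
  by_cases hx : x ∈ tsupport θ
  · exact hθ.continuousAt.smul (hH.continuousAt (hU.mem_nhds (hs hx)))
  · refine continuousAt_const (y := (0 : V)) |>.congr ?_
    filter_upwards [notMem_tsupport_iff_eventuallyEq.1 hx] with z hz
    simp [hz]

/-- A smooth nondecreasing step from `0` on `t ≤ 1` to `1` on `t ≥ 2`. -/
def smoothStep (t : ℝ) : ℝ := Real.smoothTransition (t - 1)

theorem contDiff_smoothStep : ContDiff ℝ 1 smoothStep :=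
  (Real.smoothTransition.contDiff (n := 1)).comp (contDiff_id.sub contDiff_const)

theorem hasDerivAt_smoothStep (t : ℝ) : HasDerivAt smoothStep (deriv smoothStep t) t :=
  (contDiff_smoothStep.differentiable one_ne_zero t).hasDerivAt

theorem continuous_deriv_smoothStep : Continuous (deriv smoothStep) :=
  contDiff_smoothStep.continuous_deriv le_rfl

theorem smoothStep_of_le {t : ℝ} (ht : t ≤ 1) : smoothStep t = 0 :=
  Real.smoothTransition.zero_of_nonpos (by linarith)

theorem smoothStep_of_ge {t : ℝ} (ht : 2 ≤ t) : smoothStep t = 1 :=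
  Real.smoothTransition.one_of_one_le (by linarith)

theorem deriv_smoothStep_nonneg (t : ℝ) : 0 ≤ deriv smoothStep t :=
  Monotone.deriv_nonneg fun _ _ h => Real.smoothTransition.monotone (by linarith)

theorem deriv_smoothStep_of_lt {t : ℝ} (ht : t < 1) : deriv smoothStep t = 0 := by
  have : smoothStep =ᶠ[𝓝 t] fun _ => 0 :=
    (eventually_lt_nhds ht).mono fun s hs => smoothStep_of_le (le_of_lt hs)
  simp [this.deriv_eq]

theorem deriv_smoothStep_of_gt {t : ℝ} (ht : 2 < t) : deriv smoothStep t = 0 := by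
  have : smoothStep =ᶠ[𝓝 t] fun _ => 1 :=
    (eventually_gt_nhds ht).mono fun s hs => smoothStep_of_ge (le_of_lt hs)
  simp [this.deriv_eq]

theorem hasGradientAt_comp_norm_sub_sq {E : Type*} [NormedAddCommGroup E] [InnerProductSpace ℝ E]
    [CompleteSpace E] {φ : ℝ → ℝ} {c φ' : ℝ} {x y : E} (h : HasDerivAt φ φ' (c * ‖x - y‖ ^ 2)) :
    HasGradientAt (fun x => φ (c * ‖x - y‖ ^ 2)) ((2 * c * φ') • (x - y)) x := by
  have h1 : HasFDerivAt (fun x : E => ‖x - y‖ ^ 2) (2 • innerSL ℝ (x - y)) x := by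
    simpa using ((hasFDerivAt_id x).sub_const y).norm_sq
  have h2 := h.comp_hasFDerivAt x (h1.const_mul c)
  rw [hasGradientAt_iff_hasFDerivAt]
  refine h2.congr_fderiv ?_
  ext v
  simp
  ring

/-- The radial cutoff `x ↦ ∫_{|x|}^1 g` for `g` supported in `(a, 1)`: it is constant on `|x| ≤ a`, hence
differentiable at the origin too, and its gradient is `-g(|x|) x / |x|`. -/
theorem radialCutoff_spec {E : Type*} [NormedAddCommGroup E] [InnerProductSpace ℝ E] [CompleteSpace E]
    {g : ℝ → ℝ} {a : ℝ} (hg : Continuous g) (hs : tsupport g ⊆ Ioo a 1) (ha : 0 < a) (ha1 : a < 1) :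
    ContDiff ℝ 1 (fun x : E => ∫ t in ‖x‖..1, g t) ∧
      (∀ x : E, HasGradientAt (fun x : E => ∫ t in ‖x‖..1, g t) (-(g ‖x‖ / ‖x‖) • x) x) ∧
      ∀ x : E, ‖x‖ ≤ a → ∫ t in ‖x‖..1, g t = ∫ t, g t := by
  have hg0 : ∀ t, t ∉ Ioo a 1 → g t = 0 := fun t ht =>
    image_eq_zero_of_notMem_tsupport fun h => ht (hs h)
  have hχ : ∀ s, HasDerivAt (fun s => ∫ t in s..1, g t) (-g s) s := fun s =>
    intervalIntegral.integral_hasDerivAt_left (hg.intervalIntegrable _ _)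
      hg.stronglyMeasurable.stronglyMeasurableAtFilter hg.continuousAt
  have hconst : ∀ x : E, ‖x‖ ≤ a → ∫ t in ‖x‖..1, g t = ∫ t, g t := fun x hx => by
    rw [intervalIntegral.integral_of_le (hx.trans ha1.le)]
    refine setIntegral_eq_integral_of_forall_compl_eq_zero fun t ht => hg0 t fun h => ht ?_
    exact ⟨hx.trans_lt h.1, h.2.le⟩
  have hev : ∀ x : E, ‖x‖ < a →
      (fun x : E => ∫ t in ‖x‖..1, g t) =ᶠ[𝓝 x] fun _ => ∫ t, g t := fun x hx =>
    (continuous_norm.continuousAt.eventually_lt continuousAt_const hx).mono fun z hz =>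
      hconst z (le_of_lt hz)
  have hχ1 : ContDiff ℝ 1 fun s => ∫ t in s..1, g t := by
    rw [contDiff_one_iff_deriv]
    refine ⟨fun s => (hχ s).differentiableAt, ?_⟩
    rw [show deriv (fun s => ∫ t in s..1, g t) = fun s => -g s from funext fun s => (hχ s).deriv]
    exact hg.neg
  refine ⟨contDiff_iff_contDiffAt.2 fun x => ?_, fun x => ?_, hconst⟩
  · by_cases hx : ‖x‖ < a
    · exact contDiffAt_const.congr_of_eventuallyEq (hev x hx)
    · have hx0 : x ≠ 0 := norm_pos_iff.1 (ha.trans_le (not_lt.1 hx))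
      exact hχ1.contDiffAt.comp x (contDiffAt_norm ℝ hx0)
  · by_cases hx : ‖x‖ < a
    · rw [hg0 ‖x‖ fun h => absurd h.1 (not_lt.2 hx.le), zero_div, neg_zero, zero_smul]
      exact (hasGradientAt_const x _).congr_of_eventuallyEq (hev x hx)
    · have hx0 : x ≠ 0 := norm_pos_iff.1 (ha.trans_le (not_lt.1 hx))
      have h1 : ∀ z : E, z ≠ 0 → ‖z‖ = √(1 * ‖z - 0‖ ^ 2) := fun z _ => by
        rw [sub_zero, one_mul, Real.sqrt_sq (norm_nonneg z)]
      have hsq : HasDerivAt Real.sqrt (1 / (2 * ‖x‖)) (1 * ‖x - 0‖ ^ 2) := by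
        have := Real.hasDerivAt_sqrt (x := 1 * ‖x - 0‖ ^ 2) (by simpa using hx0)
        rwa [← h1 x hx0] at this
      have h2 := hasGradientAt_comp_norm_sub_sq (φ := fun t => ∫ u in √t..1, g u) (c := 1) (x := x)
        (y := 0) ((hχ ‖x‖).comp_of_eq _ hsq (h1 x hx0))
      simp only [one_mul, sub_zero, Real.sqrt_sq (norm_nonneg _)] at h2
      convert h2 using 2
      field_simp

section Radial

variable {n : ℕ}

/-- The radial probability density obtained by pairing the kernel `E` with the gradient of the cutoff
`smoothStep (|w|²)` around its singularity. -/
def radialDensity (n : ℕ) (w : EuclideanSpace ℝ (Fin (n + 1))) : ℝ :=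
  2 * deriv smoothStep (‖w‖ ^ 2) * ((sphereVol n * ‖w‖ ^ (n + 1))⁻¹ * ‖w‖ ^ 2)

theorem radialDensity_nonneg (w : EuclideanSpace ℝ (Fin (n + 1))) : 0 ≤ radialDensity n w := by
  unfold radialDensity
  have := deriv_smoothStep_nonneg (‖w‖ ^ 2)
  have := sphereVol_pos n
  positivity

theorem radialDensity_of_gt {w : EuclideanSpace ℝ (Fin (n + 1))} (hw : 2 < ‖w‖ ^ 2) :
    radialDensity n w = 0 := by
  simp [radialDensity, deriv_smoothStep_of_gt hw]

theorem sphereVol_eq (n : ℕ) : ((n : ℝ) + 1) *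
    (volume : Measure (EuclideanSpace ℝ (Fin (n + 1)))).real (ball 0 1) = sphereVol n := by
  rw [measureReal_def, EuclideanSpace.volume_ball, ENNReal.ofReal_one, one_pow, one_mul,
    ENNReal.toReal_ofReal (by positivity), Fintype.card_fin, sphereVol]
  push_cast
  rw [Real.Gamma_add_one (by positivity), Real.sqrt_eq_rpow, ← Real.rpow_natCast, ← Real.rpow_mul
    Real.pi_pos.le]
  have := Real.Gamma_pos_of_pos (show (0 : ℝ) < ((n : ℝ) + 1) / 2 by positivity)
  push_cast
  rw [show 1 / 2 * ((n : ℝ) + 1) = ((n : ℝ) + 1) / 2 by ring]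
  field_simp

theorem integral_deriv_smoothStep_sq :
    ∫ ρ in Ioi (0 : ℝ), 2 * ρ * deriv smoothStep (ρ ^ 2) = 1 := by
  have hd : ∀ ρ : ℝ, HasDerivAt (fun ρ => smoothStep (ρ ^ 2)) (2 * ρ * deriv smoothStep (ρ ^ 2)) ρ :=
    fun ρ => by
      have := (hasDerivAt_smoothStep (ρ ^ 2)).comp ρ (hasDerivAt_pow 2 ρ)
      refine this.congr_deriv ?_
      push_cast
      ring
  have hcont : Continuous fun ρ : ℝ => 2 * ρ * deriv smoothStep (ρ ^ 2) := by
    have := continuous_deriv_smoothStep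
    fun_prop
  have h1 : ∫ ρ in Ioi (0 : ℝ), 2 * ρ * deriv smoothStep (ρ ^ 2) =
      ∫ ρ in (0 : ℝ)..2, 2 * ρ * deriv smoothStep (ρ ^ 2) := by
    rw [intervalIntegral.integral_of_le zero_le_two]
    refine setIntegral_eq_of_subset_of_forall_sdiff_eq_zero measurableSet_Ioi
      (fun x hx => hx.1) fun x hx => ?_
    have hx2 : 2 < x := not_le.1 fun h => hx.2 ⟨hx.1, h⟩
    rw [deriv_smoothStep_of_gt (by nlinarith), mul_zero]
  rw [h1, intervalIntegral.integral_eq_sub_of_hasDerivAt (fun ρ _ => hd ρ)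
    (hcont.intervalIntegrable _ _), smoothStep_of_ge (by norm_num), smoothStep_of_le (by norm_num),
    sub_zero]

theorem integral_radialDensity (n : ℕ) : ∫ w, radialDensity n w = 1 := by
  have hσ := (sphereVol_pos n).ne'
  have h := integral_fun_norm_addHaar (volume : Measure (EuclideanSpace ℝ (Fin (n + 1))))
    (fun ρ : ℝ => 2 * deriv smoothStep (ρ ^ 2) * ((sphereVol n * ρ ^ (n + 1))⁻¹ * ρ ^ 2))
  have hr : ∫ ρ in Ioi (0 : ℝ), ρ ^ n •
      (2 * deriv smoothStep (ρ ^ 2) * ((sphereVol n * ρ ^ (n + 1))⁻¹ * ρ ^ 2)) =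
      (sphereVol n)⁻¹ := by
    rw [← mul_one (sphereVol n)⁻¹, ← integral_deriv_smoothStep_sq, ← integral_const_mul]
    refine setIntegral_congr_fun measurableSet_Ioi fun ρ hρ => ?_
    have : ρ ≠ 0 := (mem_Ioi.1 hρ).ne'
    simp only [smul_eq_mul]
    field_simp
    ring
  simp only [finrank_euclideanSpace, Fintype.card_fin, Nat.add_sub_cancel] at h
  rw [hr] at h
  refine h.trans ?_
  rw [nsmul_eq_mul, smul_eq_mul, ← mul_assoc]
  push_cast
  rw [sphereVol_eq, mul_inv_cancel₀ hσ]

end Radial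

/-! ### Cauchy's integral formula at real points -/

section CauchyFormula

variable {n : ℕ}

theorem continuousOn_cauchyKernel_mul_toCliff_mul {U : Set (EuclideanSpace ℝ (Fin (n + 1)))}
    {f : EuclideanSpace ℝ (Fin (n + 1)) → Cliff n} (hf : ContinuousOn f U)
    (y z : EuclideanSpace ℝ (Fin (n + 1))) :
    ContinuousOn (fun x => cauchyKernelDiff (ofRealVec (x - y)) * toCliff (ofRealVec (x - z)) * f x)
      (U \ {y}) := by
  have h1 : ContinuousOn (fun x => cauchyKernelDiff (ofRealVec (x - y))) (U \ {y}) :=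
    (contDiffOn_cauchyKernelDiff_ofRealVec y).continuousOn.mono fun x hx => hx.2
  have h2 : Continuous fun x => toCliff (ofRealVec (x - z)) :=
    continuous_toCliff.comp (continuous_ofRealVec.comp (continuous_id.sub continuous_const))
  exact (h1.mul h2.continuousOn).mul (hf.mono sdiff_subset)

/-- Pairing the kernel with the gradient of the cutoff `smoothStep (c²|x - y|²)` gives the
rescaled density around the singularity. -/
theorem cauchyKernel_mul_gradient_smoothStep (c : ℝ) (hc : 0 < c)
    (x y : EuclideanSpace ℝ (Fin (n + 1))) :
    (2 * c ^ 2 * deriv smoothStep (c ^ 2 * ‖x - y‖ ^ 2)) •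
        (cauchyKernelDiff (ofRealVec (x - y)) * toCliff (ofRealVec (x - y))) =
      (c ^ (n + 1) * radialDensity n (c • (y - x))) • (1 : Cliff n) := by
  have hσ := (sphereVol_pos n).ne'
  rw [cauchyKernelDiff_ofRealVec_mul_toCliff, smul_smul, radialDensity, norm_smul, norm_sub_rev y x,
    Real.norm_of_nonneg hc.le, mul_pow, mul_pow]
  congr 1
  by_cases hx : ‖x - y‖ = 0
  · simp [hx]
  · field_simp

/-- Averages of a continuous function against the rescaled densities tend to its value. -/
theorem tendsto_integral_radialDensity {V : Type*} [NormedAddCommGroup V] [NormedSpace ℝ V]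
    [CompleteSpace V] {U : Set (EuclideanSpace ℝ (Fin (n + 1)))} (hU : IsOpen U)
    {f : EuclideanSpace ℝ (Fin (n + 1)) → V} (hf : ContinuousOn f U)
    {y : EuclideanSpace ℝ (Fin (n + 1))} (hy : y ∈ U) :
    Tendsto (fun c : ℝ => ∫ x, (c ^ (n + 1) * radialDensity n (c • (y - x))) • f x) atTop
      (𝓝 (f y)) := by
  obtain ⟨δ, hδ, hδU⟩ := nhds_basis_closedBall.mem_iff.1 (hU.mem_nhds hy)
  set f' := (closedBall y δ).indicator f
  have hi : Integrable f' := by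
    rw [integrable_indicator_iff measurableSet_closedBall]
    exact (hf.mono hδU).integrableOn_compact (isCompact_closedBall y δ)
  have hcont : ContinuousAt f' y := by
    refine (hf.continuousAt (hU.mem_nhds hy)).congr ?_
    filter_upwards [closedBall_mem_nhds y hδ] with x hx
    exact (indicator_of_mem hx f).symm
  have hdecay : Tendsto (fun w => ‖w‖ ^ Module.finrank ℝ (EuclideanSpace ℝ (Fin (n + 1))) *
      radialDensity n w) (Bornology.cobounded _) (𝓝 0) := by
    refine tendsto_const_nhds.congr' ?_
    filter_upwards [tendsto_norm_cobounded_atTop.eventually_gt_atTop 2] with w hw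
    rw [radialDensity_of_gt (by nlinarith), mul_zero]
  have h := tendsto_integral_comp_smul_smul_of_integrable' radialDensity_nonneg
    (integral_radialDensity n) hdecay hi hcont
  rw [show f' y = f y from indicator_of_mem (mem_closedBall_self hδ.le) f] at h
  refine h.congr' ?_
  filter_upwards [eventually_ge_atTop (2 / δ), eventually_gt_atTop 0] with c hc hc0
  refine integral_congr_ae (.of_forall fun x => ?_)
  simp only [finrank_euclideanSpace, Fintype.card_fin]
  by_cases hx : x ∈ closedBall y δ
  · rw [show f' x = f x from indicator_of_mem hx f]
  · have h1 : δ < ‖y - x‖ := by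
      rw [mem_closedBall, not_le, dist_comm, dist_eq_norm] at hx
      exact hx
    have h2 : 2 < c * ‖y - x‖ :=
      calc 2 ≤ c * δ := (div_le_iff₀ hδ).1 hc
        _ < c * ‖y - x‖ := by gcongr
    have h3 : radialDensity n (c • (y - x)) = 0 := by
      refine radialDensity_of_gt ?_
      rw [norm_smul, Real.norm_of_nonneg hc0.le]
      nlinarith
    rw [h3, mul_zero, zero_smul, zero_smul]

/-- Cauchy's formula averaged over the radii with weight `g`. The cutoff in Stokes' theorem is
`∫_{|x|}^1 g` away from `y`, corrected near `y` so as to vanish there; the correction contributes an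
average of `f` over a small neighborhood of `y`. -/
theorem integral_radial_cauchyKernel_mul {f : EuclideanSpace ℝ (Fin (n + 1)) → Cliff n}
    (hf : ContDiffOn ℝ 1 f (ball 0 1)) (hD : ∀ x ∈ ball 0 1, diracOp ℝ f x = 0)
    {y : EuclideanSpace ℝ (Fin (n + 1))} {a : ℝ} (hya : ‖y‖ < a) (ha1 : a < 1) {g : ℝ → ℝ}
    (hg : Continuous g) (hgc : HasCompactSupport g) (hs : tsupport g ⊆ Ioo a 1) :
    Integrable (fun x => (g ‖x‖ / ‖x‖) • (cauchyKernelDiff (ofRealVec (x - y)) *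
      toCliff (ofRealVec x) * f x)) ∧
    ∫ x, (g ‖x‖ / ‖x‖) • (cauchyKernelDiff (ofRealVec (x - y)) * toCliff (ofRealVec x) * f x) =
      (∫ t, g t) • f y := by
  have ha : 0 < a := (norm_nonneg y).trans_lt hya
  have hy1 : y ∈ ball (0 : EuclideanSpace ℝ (Fin (n + 1))) 1 := by
    simpa using hya.trans ha1
  have hUo : IsOpen (ball (0 : EuclideanSpace ℝ (Fin (n + 1))) 1 \ {y}) :=
    isOpen_ball.sdiff isClosed_singleton
  obtain ⟨hX1, hX2, hX3⟩ := radialCutoff_spec (E := EuclideanSpace ℝ (Fin (n + 1))) hg hs ha ha1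
  set X : EuclideanSpace ℝ (Fin (n + 1)) → ℝ := fun x => ∫ t in ‖x‖..1, g t with hX
  set A := ∫ t, g t with hA
  -- the support of `g` ends at some `b < 1`
  obtain ⟨b, hab, hb1, hgb⟩ : ∃ b, a ≤ b ∧ b < 1 ∧ ∀ t, b < t → g t = 0 := by
    by_cases hne : (tsupport g).Nonempty
    · obtain ⟨b, hb, hbm⟩ := hgc.isCompact.exists_isGreatest hne
      exact ⟨b, (hs hb).1.le, (hs hb).2, fun t ht =>
        image_eq_zero_of_notMem_tsupport fun h => absurd (hbm h) (not_le.2 ht)⟩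
    · exact ⟨a, le_rfl, ha1, fun t _ => image_eq_zero_of_notMem_tsupport fun h => hne ⟨t, h⟩⟩
  have hga : ∀ t, t ≤ a → g t = 0 := fun t ht =>
    image_eq_zero_of_notMem_tsupport fun h => absurd (hs h).1 (not_lt.2 ht)
  have hXb : ∀ x, b ≤ ‖x‖ → X x = 0 := fun x hx => by
    have h0 : ∀ t ∈ uIoc ‖x‖ 1, g t = 0 := fun t ht => by
      refine hgb t (lt_of_le_of_lt ?_ ht.1)
      exact le_inf hx hb1.le
    simpa [hX] using intervalIntegral.integral_congr_ae (μ := volume) (g := fun _ => (0 : ℝ))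
      (.of_forall h0)
  -- integrability of the weighted form
  set θ : EuclideanSpace ℝ (Fin (n + 1)) → ℝ := fun x => g ‖x‖ / ‖x‖ with hθ
  have hθsub : tsupport θ ⊆ closedBall 0 b \ ball 0 a := by
    refine closure_minimal (fun x hx => ?_) (isClosed_closedBall.sdiff isOpen_ball)
    have hgx : g ‖x‖ ≠ 0 := fun h => hx (by simp [hθ, h])
    exact ⟨by simpa using not_lt.1 fun h => hgx (hgb _ h),
      fun h => hgx (hga _ (by simpa using (mem_ball_zero_iff.1 h).le))⟩
  have hθc : Continuous θ := by
    refine continuous_iff_continuousAt.2 fun x => ?_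
    by_cases hx : x = 0
    · have : θ =ᶠ[𝓝 x] fun _ => 0 := by
        filter_upwards [ball_mem_nhds x ha] with z hz
        have : ‖z‖ < a := by simpa [hx] using hz
        simp [hθ, hga _ this.le]
      exact this.continuousAt
    · exact (hg.continuousAt.comp continuous_norm.continuousAt).div continuous_norm.continuousAt
        (norm_ne_zero_iff.2 hx)
  have hi1 : Integrable (fun x => θ x • (cauchyKernelDiff (ofRealVec (x - y)) *
      toCliff (ofRealVec x) * f x)) := by
    refine integrable_smul_of_tsupport_subset hUo hθc
      (.of_support_subset_isCompact (isCompact_closedBall 0 b)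
        ((subset_tsupport θ).trans (hθsub.trans sdiff_subset))) (hθsub.trans fun x hx => ⟨?_, ?_⟩) ?_
    · exact closedBall_subset_ball hb1 hx.1
    · rintro rfl
      exact hx.2 (by simpa using hya)
    · simpa using continuousOn_cauchyKernel_mul_toCliff_mul hf.continuousOn y 0
  refine ⟨hi1, ?_⟩
  have hlim := (tendsto_integral_radialDensity isOpen_ball hf.continuousOn hy1).const_smul A
  refine tendsto_nhds_unique (tendsto_const_nhds.congr' ?_) hlim
  -- the radius of the correction is less than `a - |y|`
  filter_upwards [eventually_gt_atTop (2 / (a - ‖y‖))] with c hc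
  have hd : 0 < a - ‖y‖ := sub_pos.2 hya
  have hc0 : 0 < c := lt_trans (by positivity) hc
  have hcd : 2 < c * (a - ‖y‖) := (div_lt_iff₀ hd).1 hc
  have hfar : ∀ x, c ^ 2 * ‖x - y‖ ^ 2 ≤ 2 → ‖x‖ < a := fun x hx => by
    by_contra hxa
    have h1 : a - ‖y‖ ≤ ‖x - y‖ := by linarith [norm_sub_norm_le x y, not_lt.1 hxa]
    have h2 : 2 < c * ‖x - y‖ := hcd.trans_le (by gcongr)
    nlinarith
  set Ψ : EuclideanSpace ℝ (Fin (n + 1)) → ℝ := fun x => smoothStep (c ^ 2 * ‖x - y‖ ^ 2) with hΨ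
  set τ : EuclideanSpace ℝ (Fin (n + 1)) → ℝ :=
    fun x => 2 * c ^ 2 * deriv smoothStep (c ^ 2 * ‖x - y‖ ^ 2) with hτ
  have hsq : Continuous fun x : EuclideanSpace ℝ (Fin (n + 1)) => c ^ 2 * ‖x - y‖ ^ 2 := by fun_prop
  have hΨ1 : ContDiff ℝ 1 Ψ := by
    refine contDiff_smoothStep.comp (contDiff_const.mul ?_)
    exact (contDiff_id.sub contDiff_const).norm_sq ℝ
  have hΨg : ∀ x, HasGradientAt Ψ (τ x • (x - y)) x := fun x =>
    hasGradientAt_comp_norm_sub_sq (hasDerivAt_smoothStep _)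
  have hτc : Continuous τ := continuous_const.mul (continuous_deriv_smoothStep.comp hsq)
  have hτsub : tsupport τ ⊆ {x | c ^ 2 * ‖x - y‖ ^ 2 ∈ Icc 1 2} := by
    refine closure_minimal (fun x hx => ?_) (isClosed_Icc.preimage hsq)
    by_contra h
    rcases not_and_or.1 h with h | h
    · exact hx (by simp [hτ, deriv_smoothStep_of_lt (not_le.1 h)])
    · exact hx (by simp [hτ, deriv_smoothStep_of_gt (not_le.1 h)])
  have hτa : tsupport τ ⊆ closedBall 0 a := fun x hx => by
    simpa using (hfar x (hτsub hx).2).le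
  have hi2 : Integrable (fun x => τ x • (cauchyKernelDiff (ofRealVec (x - y)) *
      toCliff (ofRealVec (x - y)) * f x)) := by
    refine integrable_smul_of_tsupport_subset hUo hτc
      (.of_support_subset_isCompact (isCompact_closedBall 0 a) ((subset_tsupport τ).trans hτa))
      (fun x hx => ⟨closedBall_subset_ball ha1 (hτa hx), ?_⟩)
      (continuousOn_cauchyKernel_mul_toCliff_mul hf.continuousOn y y)
    rintro rfl
    have := (hτsub hx).1
    norm_num at this
  -- the cutoff that vanishes near `y`
  set Φ : EuclideanSpace ℝ (Fin (n + 1)) → ℝ := fun x => X x + A * (Ψ x - 1) with hΦ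
  have hΦ1 : ContDiff ℝ 1 Φ := hX1.add (contDiff_const.mul (hΨ1.sub contDiff_const))
  have hΦg : ∀ x, HasGradientAt Φ (-(θ x) • x + (A * τ x) • (x - y)) x := fun x => by
    have h1 := (hX2 x).hasFDerivAt.add (((hΨg x).hasFDerivAt.sub_const 1).const_mul A)
    rw [hasGradientAt_iff_hasFDerivAt]
    refine h1.congr_fderiv ?_
    simp only [map_add, map_smul, mul_smul, hθ]
  have hΦsub : tsupport Φ ⊆ closedBall 0 b := by
    refine closure_minimal (fun x hx => ?_) isClosed_closedBall
    by_contra h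
    have hbx : b < ‖x‖ := by simpa using h
    refine hx ?_
    have h1 : 2 ≤ c ^ 2 * ‖x - y‖ ^ 2 := by
      by_contra h2
      exact absurd (hfar x (not_le.1 h2).le) (not_lt.2 (hab.trans hbx.le))
    simp [hΦ, hXb x hbx.le, hΨ, smoothStep_of_ge h1]
  have hΦy : y ∉ tsupport Φ := by
    rw [notMem_tsupport_iff_eventuallyEq]
    have h1 : ∀ᶠ x in 𝓝 y, c ^ 2 * ‖x - y‖ ^ 2 < 1 :=
      hsq.continuousAt.eventually_lt continuousAt_const (by simp)
    filter_upwards [h1] with x hx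
    have h2 : X x = A := hX3 x (hfar x (by linarith)).le
    simp [hΦ, hΨ, h2, smoothStep_of_le hx.le]
  have hstokes := integral_cauchyKernel_mul_gradient_mul (y := y) isOpen_ball hf hD hΦ1
    (.of_support_subset_isCompact (isCompact_closedBall 0 b) ((subset_tsupport Φ).trans hΦsub)) hΦg
    (fun x hx => ⟨closedBall_subset_ball hb1 (hΦsub hx), fun h => hΦy (mem_singleton_iff.1 h ▸ hx)⟩)
  have hsplit : ∀ x, cauchyKernelDiff (ofRealVec (x - y)) *
      toCliff (ofRealVec (-(θ x) • x + (A * τ x) • (x - y))) * f x =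
      A • ((c ^ (n + 1) * radialDensity n (c • (y - x))) • f x) -
        θ x • (cauchyKernelDiff (ofRealVec (x - y)) * toCliff (ofRealVec x) * f x) := fun x => by
    have h1 : toCliff (ofRealVec (-(θ x) • x + (A * τ x) • (x - y))) =
        -(θ x) • toCliff (ofRealVec x) + (A * τ x) • toCliff (ofRealVec (x - y)) := by
      rw [ofRealVec_add, ofRealVec_smul, ofRealVec_smul, ← toCliff_real_smul, ← toCliff_real_smul]
      exact (toCliffCLM n).map_add _ _
    have h2 := cauchyKernel_mul_gradient_smoothStep c hc0 x y
    rw [h1, mul_add, add_mul, mul_smul_comm, mul_smul_comm, smul_mul_assoc, smul_mul_assoc, mul_smul,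
      ← smul_mul_assoc (τ x), h2, smul_mul_assoc, one_mul, neg_smul]
    abel
  have hi2' : Integrable fun x => (c ^ (n + 1) * radialDensity n (c • (y - x))) • f x := by
    refine hi2.congr (.of_forall fun x => ?_)
    have h2 := cauchyKernel_mul_gradient_smoothStep c hc0 x y
    simp only [hτ]
    rw [← smul_mul_assoc, h2, smul_mul_assoc, one_mul]
  have hi3 : Integrable fun x => A • ((c ^ (n + 1) * radialDensity n (c • (y - x))) • f x) :=
    hi2'.smul A
  rw [integral_congr_ae (.of_forall hsplit), integral_sub hi3 hi1, integral_smul] at hstokes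
  exact (sub_eq_zero.1 hstokes).symm

/-- Cauchy's integral formula at the points of the real ball. -/
theorem cauchyFormula_real {f : EuclideanSpace ℝ (Fin (n + 1)) → Cliff n}
    (hf : ContDiffOn ℝ 1 f (ball 0 1)) (hD : ∀ x ∈ ball 0 1, diracOp ℝ f x = 0)
    {y : EuclideanSpace ℝ (Fin (n + 1))} {r : ℝ} (hyr : ‖y‖ < r) (hr1 : r < 1) :
    r ^ n • ∫ ω : sphere (0 : EuclideanSpace ℝ (Fin (n + 1))) 1,
      cauchyKernelDiff (ofRealVec (r • (ω : EuclideanSpace ℝ (Fin (n + 1))) - y)) *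
        toCliff (ofRealVec (ω : EuclideanSpace ℝ (Fin (n + 1)))) *
          f (r • (ω : EuclideanSpace ℝ (Fin (n + 1)))) ∂(surfaceMeasure n) = f y := by
  obtain ⟨a, hya, har⟩ := exists_between hyr
  have ha : 0 < a := (norm_nonneg y).trans_lt hya
  have ha1 : a < 1 := har.trans hr1
  set Q : ℝ → sphere (0 : EuclideanSpace ℝ (Fin (n + 1))) 1 → Cliff n := fun ρ ω =>
    cauchyKernelDiff (ofRealVec (ρ • (ω : EuclideanSpace ℝ (Fin (n + 1))) - y)) *
      toCliff (ofRealVec (ω : EuclideanSpace ℝ (Fin (n + 1)))) *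
        f (ρ • (ω : EuclideanSpace ℝ (Fin (n + 1)))) with hQ
  have hnorm : ∀ (ρ : ℝ) (ω : sphere (0 : EuclideanSpace ℝ (Fin (n + 1))) 1), 0 < ρ →
      ‖ρ • (ω : EuclideanSpace ℝ (Fin (n + 1)))‖ = ρ := fun ρ ω hρ => by
    simp [norm_smul, abs_of_pos hρ]
  have hQc : ContinuousOn Q.uncurry (Ioo a 1 ×ˢ univ) := by
    have hm : Continuous fun p : ℝ × sphere (0 : EuclideanSpace ℝ (Fin (n + 1))) 1 =>
        p.1 • (p.2 : EuclideanSpace ℝ (Fin (n + 1))) := by fun_prop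
    have h1 : ContinuousOn (fun p : ℝ × sphere (0 : EuclideanSpace ℝ (Fin (n + 1))) 1 =>
        cauchyKernelDiff (ofRealVec (p.1 • (p.2 : EuclideanSpace ℝ (Fin (n + 1))) - y)))
        (Ioo a 1 ×ˢ univ) :=
      (contDiffOn_cauchyKernelDiff_ofRealVec y).continuousOn.comp hm.continuousOn fun p hp h => by
        have := hnorm p.1 p.2 (ha.trans hp.1.1)
        rw [show p.1 • (p.2 : EuclideanSpace ℝ (Fin (n + 1))) = y from h] at this
        exact absurd hya (not_lt.2 (this ▸ hp.1.1.le))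
    have h2 : Continuous fun p : ℝ × sphere (0 : EuclideanSpace ℝ (Fin (n + 1))) 1 =>
        toCliff (ofRealVec (p.2 : EuclideanSpace ℝ (Fin (n + 1)))) :=
      continuous_toCliff.comp (continuous_ofRealVec.comp (continuous_subtype_val.comp continuous_snd))
    have h3 : ContinuousOn (fun p : ℝ × sphere (0 : EuclideanSpace ℝ (Fin (n + 1))) 1 =>
        f (p.1 • (p.2 : EuclideanSpace ℝ (Fin (n + 1))))) (Ioo a 1 ×ˢ univ) :=
      hf.continuousOn.comp hm.continuousOn fun p hp => by
        rw [mem_ball_zero_iff, hnorm p.1 p.2 (ha.trans hp.1.1)]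
        exact hp.1.2
    exact (h1.mul h2.continuousOn).mul h3
  set K : ℝ → Cliff n := fun ρ => ρ ^ n • ∫ ω, Q ρ ω ∂(surfaceMeasure n) with hK
  have : IsFiniteMeasure (surfaceMeasure n) := by
    unfold surfaceMeasure
    infer_instance
  have hKc : ContinuousOn K (Ioo a 1) := by
    refine (continuous_pow n).continuousOn.smul ?_
    exact continuousOn_integral_of_compact_support isCompact_univ hQc
      fun p ω _ h => absurd (mem_univ ω) h
  have hKf : ContinuousOn (fun ρ => K ρ - f y) (Ioo a 1) := hKc.sub continuousOn_const
  -- the averaged formula determines `K` on `(a, 1)`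
  have hweak : ∀ g : ℝ → ℝ, ContDiff ℝ (⊤ : ℕ∞) g → HasCompactSupport g → tsupport g ⊆ Ioo a 1 →
      ∫ ρ, g ρ • (K ρ - f y) = 0 := fun g hg hgc hgs => by
    have hg0 : ∀ t, t ∉ Ioo a 1 → g t = 0 := fun t ht =>
      image_eq_zero_of_notMem_tsupport fun h => ht (hgs h)
    obtain ⟨hi, hI⟩ := integral_radial_cauchyKernel_mul hf hD hya ha1 hg.continuous hgc hgs
    rw [integral_eq_integral_Ioi_sphere hi] at hI
    have h1 : ∫ ρ in Ioi (0 : ℝ), g ρ • K ρ = (∫ t, g t) • f y := by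
      rw [← hI]
      refine setIntegral_congr_fun measurableSet_Ioi fun ρ hρ => ?_
      have hρ0 : ρ ≠ 0 := (mem_Ioi.1 hρ).ne'
      simp only [hK, finrank_euclideanSpace, Fintype.card_fin, Nat.add_sub_cancel]
      rw [smul_comm, ← integral_smul]
      congr 1
      refine integral_congr_ae (.of_forall fun ω => ?_)
      simp only [hnorm ρ ω hρ, hQ, ofRealVec_smul ρ, toCliff_real_smul, mul_smul_comm,
        smul_mul_assoc, smul_smul, div_mul_cancel₀ _ hρ0]
    have h2 : ∫ ρ in Ioi (0 : ℝ), g ρ • K ρ = ∫ ρ, g ρ • K ρ := by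
      refine setIntegral_eq_integral_of_forall_compl_eq_zero fun t ht => ?_
      rw [hg0 t fun h => ht (ha.trans h.1), zero_smul]
    have hi1 : Integrable fun ρ => g ρ • K ρ :=
      integrable_smul_of_tsupport_subset isOpen_Ioo hg.continuous hgc hgs hKc
    have hi2 : Integrable fun ρ => g ρ • f y :=
      (hg.continuous.integrable_of_hasCompactSupport hgc).smul_const _
    simp only [smul_sub]
    rw [integral_sub hi1 hi2, ← h2, h1, integral_smul_const, sub_self]
  have hae := isOpen_Ioo.ae_eq_zero_of_integral_contDiff_smul_eq_zero
    (hKf.locallyIntegrableOn measurableSet_Ioo) hweak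
  have heq : EqOn (fun ρ => K ρ - f y) (fun _ => 0) (Ioo a 1) :=
    Measure.eqOn_open_of_ae_eq ((ae_restrict_iff' measurableSet_Ioo).2 hae) isOpen_Ioo hKf
      continuousOn_const
  exact sub_eq_zero.1 (heq ⟨har, hr1⟩)

end CauchyFormula

/-! ### The Cauchy integral as a complex regular function -/

theorem contDiffOn_integral_of_compactSpace {H V Y : Type*} [NormedAddCommGroup H]
    [NormedSpace ℂ H] [LocallyCompactSpace H] [NormedAddCommGroup V] [NormedSpace ℂ V]
    [TopologicalSpace Y] [CompactSpace Y] [SecondCountableTopology Y] [MeasurableSpace Y]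
    [OpensMeasurableSpace Y] {μ : Measure Y} [IsFiniteMeasure μ] {U : Set H} (hU : IsOpen U)
    {F : H → Y → V} {F' : H → Y → H →L[ℂ] V} (hF : ContinuousOn F.uncurry (U ×ˢ univ))
    (hF' : ContinuousOn F'.uncurry (U ×ˢ univ))
    (hd : ∀ x ∈ U, ∀ y, HasFDerivAt (fun x => F x y) (F' x y) x) :
    (∀ x ∈ U, HasFDerivAt (fun x => ∫ y, F x y ∂μ) (∫ y, F' x y ∂μ) x) ∧
      ContDiffOn ℂ 1 (fun x => ∫ y, F x y ∂μ) U := by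
  have hFc : ∀ x ∈ U, Continuous (F x) := fun x hx =>
    continuousOn_univ.1 (hF.comp (f := fun y => (x, y)) (by fun_prop) fun y _ => ⟨hx, mem_univ y⟩)
  have hFc' : ∀ x ∈ U, Continuous (F' x) := fun x hx =>
    continuousOn_univ.1 (hF'.comp (f := fun y => (x, y)) (by fun_prop) fun y _ => ⟨hx, mem_univ y⟩)
  have h1 : ∀ x ∈ U, HasFDerivAt (fun x => ∫ y, F x y ∂μ) (∫ y, F' x y ∂μ) x := fun x hx => by
    obtain ⟨s, hs, hxs, hsU⟩ := exists_compact_subset hU hx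
    obtain ⟨C, hC⟩ := (hs.prod isCompact_univ).exists_bound_of_continuousOn
      (hF'.mono (prod_mono_left hsU))
    refine hasFDerivAt_integral_of_dominated_of_fderiv_le (bound := fun _ => C)
      (mem_interior_iff_mem_nhds.1 hxs) ?_ ?_ ?_ ?_ (integrable_const C) ?_
    · filter_upwards [hU.mem_nhds hx] with z hz
      exact (hFc z hz).aestronglyMeasurable
    · exact (hFc x hx).integrable_of_hasCompactSupport (.of_compactSpace _)
    · exact (hFc' x hx).aestronglyMeasurable
    · exact .of_forall fun y z hz => hC (z, y) ⟨hz, mem_univ y⟩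
    · exact .of_forall fun y z hz => hd z (hsU hz) y
  refine ⟨h1, fun x hx => ContDiffAt.contDiffWithinAt ?_⟩
  exact contDiffAt_one_iff.2 ⟨_, U, hU.mem_nhds hx,
    continuousOn_integral_of_compact_support isCompact_univ hF'
      fun p y _ h => absurd (mem_univ y) h, h1⟩

section CauchyIntegral

variable {n : ℕ}

instance : IsFiniteMeasure (surfaceMeasure n) := by
  unfold surfaceMeasure
  infer_instance

theorem continuousOn_cauchyKernelDeriv :
    ContinuousOn (cauchyKernelDeriv (n := n)) {z | sqC z ∈ regularValues n} :=
  ((contDiffOn_cauchyKernelDiff (n := n)).continuousOn_fderiv_of_isOpen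
    isOpen_sqC_mem_regularValues le_rfl).congr fun _ hz => (hasFDerivAt_cauchyKernelDiff hz).fderiv.symm

/-- The Cauchy integral over `r S^n` of a function on `ℝ^{n+1}`, as a function of `ζ ∈ ℂ^{n+1}`. -/
def sphereIntegral (f : EuclideanSpace ℝ (Fin (n + 1)) → Cliff n) (r : ℝ)
    (ζ : EuclideanSpace ℂ (Fin (n + 1))) : Cliff n :=
  r ^ n • ∫ ω : sphere (0 : EuclideanSpace ℝ (Fin (n + 1))) 1,
    cauchyKernelDiff (ofRealVec (r • (ω : EuclideanSpace ℝ (Fin (n + 1)))) - ζ) *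
      toCliff (ofRealVec (ω : EuclideanSpace ℝ (Fin (n + 1)))) *
        f (r • (ω : EuclideanSpace ℝ (Fin (n + 1)))) ∂(surfaceMeasure n)

/-- The linear form through which the Dirac operator depends on the derivative. -/
def diracSymbol (n : ℕ) : (EuclideanSpace ℂ (Fin (n + 1)) →L[ℂ] Cliff n) →L[ℂ] Cliff n :=
  ∑ j, (mulCLM n (basisVec j)).comp
    (ContinuousLinearMap.apply ℂ (Cliff n) (EuclideanSpace.single j (1 : ℂ)))

theorem diracSymbol_apply (L : EuclideanSpace ℂ (Fin (n + 1)) →L[ℂ] Cliff n) :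
    diracSymbol n L = ∑ j, basisVec j * L (EuclideanSpace.single j 1) := by
  simp [diracSymbol]

theorem isOpen_lieGauge_lt {k : ℕ} (R : ℝ) :
    IsOpen {ζ : EuclideanSpace ℂ (Fin k) | lieGauge ζ < R} :=
  isOpen_lt continuous_lieGauge continuous_const

variable {f : EuclideanSpace ℝ (Fin (n + 1)) → Cliff n} {r : ℝ}

theorem sqC_smul_sphere_sub_mem (hr0 : 0 < r) {ζ : EuclideanSpace ℂ (Fin (n + 1))}
    (hζ : lieGauge ζ < r ^ 2) (ω : sphere (0 : EuclideanSpace ℝ (Fin (n + 1))) 1) :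
    sqC (ofRealVec (r • (ω : EuclideanSpace ℝ (Fin (n + 1)))) - ζ) ∈ regularValues n :=
  sqC_sub_mem_regularValues (by simpa [norm_smul, abs_of_pos hr0] using hζ)

theorem continuous_smul_sphere (r : ℝ) :
    Continuous fun ω : sphere (0 : EuclideanSpace ℝ (Fin (n + 1))) 1 =>
      ofRealVec (r • (ω : EuclideanSpace ℝ (Fin (n + 1)))) :=
  continuous_ofRealVec.comp (continuous_subtype_val.const_smul r)

theorem continuous_normal_mul (hf : ContinuousOn f (ball 0 1)) (hr0 : 0 < r) (hr1 : r < 1) :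
    Continuous fun ω : sphere (0 : EuclideanSpace ℝ (Fin (n + 1))) 1 =>
      toCliff (ofRealVec (ω : EuclideanSpace ℝ (Fin (n + 1)))) *
        f (r • (ω : EuclideanSpace ℝ (Fin (n + 1)))) := by
  have h2 : Continuous fun ω : sphere (0 : EuclideanSpace ℝ (Fin (n + 1))) 1 =>
      toCliff (ofRealVec (ω : EuclideanSpace ℝ (Fin (n + 1)))) :=
    continuous_toCliff.comp (continuous_ofRealVec.comp continuous_subtype_val)
  have h3 : Continuous fun ω : sphere (0 : EuclideanSpace ℝ (Fin (n + 1))) 1 =>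
      f (r • (ω : EuclideanSpace ℝ (Fin (n + 1)))) :=
    hf.comp_continuous (continuous_subtype_val.const_smul r) (smul_sphere_mem_ball hr0 hr1)
  exact h2.mul h3

theorem integrable_cauchyKernel_mul (hf : ContinuousOn f (ball 0 1)) (hr0 : 0 < r) (hr1 : r < 1)
    {ζ : EuclideanSpace ℂ (Fin (n + 1))} (hζ : lieGauge ζ < r ^ 2) :
    Integrable (fun ω : sphere (0 : EuclideanSpace ℝ (Fin (n + 1))) 1 =>
      cauchyKernelDiff (ofRealVec (r • (ω : EuclideanSpace ℝ (Fin (n + 1)))) - ζ) *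
        toCliff (ofRealVec (ω : EuclideanSpace ℝ (Fin (n + 1)))) *
          f (r • (ω : EuclideanSpace ℝ (Fin (n + 1))))) (surfaceMeasure n) := by
  refine Continuous.integrable_of_hasCompactSupport ?_ (.of_compactSpace _)
  simp only [mul_assoc]
  refine Continuous.mul ?_ (continuous_normal_mul hf hr0 hr1)
  exact contDiffOn_cauchyKernelDiff.continuousOn.comp_continuous
    ((continuous_smul_sphere r).sub continuous_const) (sqC_smul_sphere_sub_mem hr0 hζ)

/-- The Cauchy integral over `r S^n` is complex regular on `r L_{n+1}`. -/
theorem sphereIntegral_regular (hf : ContinuousOn f (ball 0 1)) (hr0 : 0 < r) (hr1 : r < 1) :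
    ContDiffOn ℂ 1 (sphereIntegral f r) {ζ | lieGauge ζ < r ^ 2} ∧
      ∀ ζ, lieGauge ζ < r ^ 2 → diracOp ℂ (sphereIntegral f r) ζ = 0 := by
  set v : sphere (0 : EuclideanSpace ℝ (Fin (n + 1))) 1 → Cliff n := fun ω =>
    toCliff (ofRealVec (ω : EuclideanSpace ℝ (Fin (n + 1)))) *
      f (r • (ω : EuclideanSpace ℝ (Fin (n + 1)))) with hv
  have hvc : Continuous v := continuous_normal_mul hf hr0 hr1
  set F : EuclideanSpace ℂ (Fin (n + 1)) → sphere (0 : EuclideanSpace ℝ (Fin (n + 1))) 1 → Cliff n :=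
    fun ζ ω => cauchyKernelDiff (ofRealVec (r • (ω : EuclideanSpace ℝ (Fin (n + 1)))) - ζ) * v ω
    with hF
  set F' : EuclideanSpace ℂ (Fin (n + 1)) → sphere (0 : EuclideanSpace ℝ (Fin (n + 1))) 1 →
      EuclideanSpace ℂ (Fin (n + 1)) →L[ℂ] Cliff n := fun ζ ω => ((mulCLM n).flip (v ω)).comp
        (-cauchyKernelDeriv (ofRealVec (r • (ω : EuclideanSpace ℝ (Fin (n + 1)))) - ζ)) with hF'
  have hsub : Continuous fun p : EuclideanSpace ℂ (Fin (n + 1)) ×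
      sphere (0 : EuclideanSpace ℝ (Fin (n + 1))) 1 =>
        ofRealVec (r • (p.2 : EuclideanSpace ℝ (Fin (n + 1)))) - p.1 :=
    ((continuous_smul_sphere r).comp continuous_snd).sub continuous_fst
  have hmaps : MapsTo (fun p : EuclideanSpace ℂ (Fin (n + 1)) ×
      sphere (0 : EuclideanSpace ℝ (Fin (n + 1))) 1 =>
        ofRealVec (r • (p.2 : EuclideanSpace ℝ (Fin (n + 1)))) - p.1)
      ({ζ | lieGauge ζ < r ^ 2} ×ˢ univ) {z | sqC z ∈ regularValues n} := fun p hp =>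
    sqC_smul_sphere_sub_mem hr0 hp.1 p.2
  have hFc : ContinuousOn F.uncurry ({ζ | lieGauge ζ < r ^ 2} ×ˢ univ) :=
    (contDiffOn_cauchyKernelDiff.continuousOn.comp hsub.continuousOn hmaps).mul
      (hvc.comp continuous_snd).continuousOn
  have hFc' : ContinuousOn F'.uncurry ({ζ | lieGauge ζ < r ^ 2} ×ˢ univ) :=
    (((mulCLM n).flip.continuous.comp (hvc.comp continuous_snd)).continuousOn).clm_comp
      (continuousOn_cauchyKernelDeriv.comp hsub.continuousOn hmaps).neg
  have hd : ∀ ζ ∈ {ζ | lieGauge ζ < r ^ 2}, ∀ ω, HasFDerivAt (fun ζ => F ζ ω) (F' ζ ω) ζ :=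
    fun ζ hζ ω => by
      have h1 := (hasFDerivAt_cauchyKernelDiff (sqC_smul_sphere_sub_mem hr0 hζ ω)).comp ζ
        ((hasFDerivAt_id ζ).const_sub (ofRealVec (r • (ω : EuclideanSpace ℝ (Fin (n + 1))))))
      have h2 := ((mulCLM n).flip (v ω)).hasFDerivAt.comp ζ h1
      refine h2.congr_fderiv ?_
      ext x
      simp [hF']
  obtain ⟨hder, hcd⟩ := contDiffOn_integral_of_compactSpace (μ := surfaceMeasure n)
    (isOpen_lieGauge_lt (r ^ 2)) hFc hFc' hd
  have hsi : sphereIntegral f r = fun ζ => r ^ n • ∫ ω, F ζ ω ∂(surfaceMeasure n) := by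
    funext ζ
    simp only [sphereIntegral, hF, hv, mul_assoc]
  refine ⟨by rw [hsi]; exact hcd.const_smul _, fun ζ hζ => ?_⟩
  have h0 : ∀ ω, diracSymbol n (F' ζ ω) = 0 := fun ω => by
    have hz := ne_zero_of_mem_regularValues (sqC_smul_sphere_sub_mem hr0 hζ ω)
    have h1 : ∀ j, basisVec j * F' ζ ω (EuclideanSpace.single j 1) =
        -(basisVec j * cauchyKernelDeriv
          (ofRealVec (r • (ω : EuclideanSpace ℝ (Fin (n + 1)))) - ζ)
            (EuclideanSpace.single j 1) * v ω) := fun j => by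
      simp [hF', mul_assoc]
    rw [diracSymbol_apply]
    simp only [h1, Finset.sum_neg_distrib, ← Finset.sum_mul]
    rw [sum_basisVec_mul_cauchyKernelDeriv hz, zero_mul, neg_zero]
  have hi : Integrable (F' ζ) (surfaceMeasure n) :=
    (continuousOn_univ.1 (hFc'.comp (f := fun ω => (ζ, ω)) (by fun_prop)
      fun ω _ => ⟨hζ, mem_univ ω⟩)).integrable_of_hasCompactSupport (.of_compactSpace _)
  have h2 : diracSymbol n (∫ ω, F' ζ ω ∂(surfaceMeasure n)) = 0 := by
    rw [← (diracSymbol n).integral_comp_comm hi]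
    simp [h0]
  have h3 : fderiv ℂ (sphereIntegral f r) ζ = r ^ n • ∫ ω, F' ζ ω ∂(surfaceMeasure n) := by
    rw [hsi]
    exact ((hder ζ hζ).const_smul (r ^ n)).fderiv
  have h4 : diracOp ℂ (sphereIntegral f r) ζ = diracSymbol n (fderiv ℂ (sphereIntegral f r) ζ) :=
    (diracSymbol_apply _).symm
  rw [h4, h3, (diracSymbol n).map_smul_of_tower, h2, smul_zero]

theorem sphereIntegral_ofRealVec (hf : ContDiffOn ℝ 1 f (ball 0 1))
    (hD : ∀ x ∈ ball 0 1, diracOp ℝ f x = 0) {y : EuclideanSpace ℝ (Fin (n + 1))} (hyr : ‖y‖ < r)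
    (hr1 : r < 1) : sphereIntegral f r (ofRealVec y) = f y := by
  rw [← cauchyFormula_real hf hD hyr hr1, sphereIntegral]
  simp only [ofRealVec_sub]

end CauchyIntegral

/-! ### Uniqueness of the extension -/

/-- A holomorphic function near `{lieGauge < R}` is determined by its values at the real points: for
`ζ = ξ + iη` the segment from `ξ` to `ζ` stays in this set, and `w ↦ g(ξ + wη)` vanishes for small
real `w`. -/
theorem eq_zero_of_real_eq_zero {k : ℕ} {V : Type*} [NormedAddCommGroup V] [NormedSpace ℂ V]
    [CompleteSpace V] {R : ℝ} {g : EuclideanSpace ℂ (Fin k) → V}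
    (hg : DifferentiableOn ℂ g {ζ | lieGauge ζ < R})
    (h0 : ∀ x : EuclideanSpace ℝ (Fin k), ‖x‖ ^ 2 < R → g (ofRealVec x) = 0)
    {ζ : EuclideanSpace ℂ (Fin k)} (hζ : lieGauge ζ < R) : g ζ = 0 := by
  set ℓ : ℂ → EuclideanSpace ℂ (Fin k) :=
    fun w => ofRealVec (reVec ζ) + w • ofRealVec (imVec ζ) with hℓ
  have hℓd : Differentiable ℂ ℓ := by
    simp only [hℓ]
    fun_prop
  set O : Set ℂ := ℓ ⁻¹' {ζ | lieGauge ζ < R} with hO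
  have hOo : IsOpen O := (isOpen_lt continuous_lieGauge continuous_const).preimage hℓd.continuous
  have hφ : DifferentiableOn ℂ (g ∘ ℓ) O := hg.comp hℓd.differentiableOn fun w hw => hw
  set T : Set ℂ := (fun b : ℝ => (b : ℂ) * Complex.I) '' Icc 0 1 with hT
  have hTc : IsPreconnected T :=
    isPreconnected_Icc.image _ (by fun_prop)
  have hTO : T ⊆ O := by
    rintro _ ⟨b, ⟨hb0, hb1⟩, rfl⟩
    have hb : b ^ 2 ≤ 1 := pow_le_one₀ hb0 hb1
    have hre : reVec (ℓ (b * Complex.I)) = reVec ζ := by ext j; simp [hℓ]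
    have him : imVec (ℓ (b * Complex.I)) = b • imVec ζ := by ext j; simp [hℓ]
    have hgram := gram_nonneg (reVec ζ) (imVec ζ)
    refine lt_of_le_of_lt ?_ hζ
    rw [lieGauge, lieGauge, hre, him, norm_smul, mul_pow, Real.norm_eq_abs, sq_abs,
      real_inner_smul_right]
    have h1 : b ^ 2 * ‖imVec ζ‖ ^ 2 ≤ ‖imVec ζ‖ ^ 2 := mul_le_of_le_one_left (by positivity) hb
    have h2 : √(‖reVec ζ‖ ^ 2 * (b ^ 2 * ‖imVec ζ‖ ^ 2) - (b * ⟪reVec ζ, imVec ζ⟫) ^ 2) ≤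
        √(‖reVec ζ‖ ^ 2 * ‖imVec ζ‖ ^ 2 - ⟪reVec ζ, imVec ζ⟫ ^ 2) := by
      refine Real.sqrt_le_sqrt ?_
      nlinarith [mul_le_of_le_one_left hgram hb]
    linarith
  have han : AnalyticOnNhd ℂ (g ∘ ℓ) T := fun w hw => hφ.analyticAt (hOo.mem_nhds (hTO hw))
  have h0T : (0 : ℂ) ∈ T := ⟨0, by simp, by simp⟩
  have hfreq : ∃ᶠ w in 𝓝[≠] (0 : ℂ), (g ∘ ℓ) w = 0 := by
    have htend : Tendsto (fun t : ℝ => (t : ℂ)) (𝓝[≠] 0) (𝓝[≠] 0) := by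
      refine tendsto_nhdsWithin_iff.2 ⟨?_, ?_⟩
      · have : Tendsto (fun t : ℝ => (t : ℂ)) (𝓝 0) (𝓝 ((0 : ℝ) : ℂ)) :=
          Complex.continuous_ofReal.tendsto 0
        rw [Complex.ofReal_zero] at this
        exact this.mono_left nhdsWithin_le_nhds
      · filter_upwards [self_mem_nhdsWithin] with t ht
        simpa using ht
    refine htend.frequently (Eventually.frequently ?_)
    have hO0 : ∀ᶠ t : ℝ in 𝓝 0, (t : ℂ) ∈ O :=
      (hOo.preimage Complex.continuous_ofReal).mem_nhds (by simpa using hTO h0T)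
    filter_upwards [hO0.filter_mono nhdsWithin_le_nhds] with t ht
    have h1 : ℓ t = ofRealVec (reVec ζ + t • imVec ζ) := by
      rw [ofRealVec_add, ofRealVec_smul, ← Complex.coe_smul]
    rw [hO, mem_preimage, h1, mem_ofPred_eq, lieGauge_ofRealVec] at ht
    rw [Function.comp_apply, h1]
    exact h0 _ ht
  have h := han.eqOn_zero_of_preconnected_of_frequently_eq_zero hTc h0T hfreq
    (show Complex.I ∈ T from ⟨1, by simp, by simp⟩)
  have hζI : ℓ Complex.I = ζ := ofRealVec_reVec_add ζ
  rwa [Function.comp_apply, hζI] at h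

/-! ### Restriction and extension -/

section Extension

variable {n : ℕ}

theorem mapsTo_restrictReal : MapsTo restrictReal (complexRegular (lieBall (n + 1)))
    (leftMonogenic (ball (0 : EuclideanSpace ℝ (Fin (n + 1))) 1)) := by
  rintro g ⟨F, hFg, hF, hD⟩
  have hd : ∀ x ∈ ball (0 : EuclideanSpace ℝ (Fin (n + 1))) 1,
      HasFDerivAt (F ∘ ofRealVec)
        (((fderiv ℂ F (ofRealVec x)).restrictScalars ℝ).comp (ofRealVecCLM (n + 1))) x := fun x hx => by
    have h1 := ((hF.contDiffAt (isOpen_lieBall.mem_nhds (ofRealVec_mem_lieBall hx))).differentiableAt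
      one_ne_zero).hasFDerivAt.restrictScalars ℝ
    exact h1.comp x (ofRealVecCLM (n + 1)).hasFDerivAt
  refine ⟨F ∘ ofRealVec, fun x => hFg ⟨_, ofRealVec_mem_lieBall x.2⟩, ?_, fun x hx => ?_⟩
  · exact (hF.restrict_scalars ℝ).comp (ofRealVecCLM (n + 1)).contDiff.contDiffOn
      fun x hx => ofRealVec_mem_lieBall hx
  · rw [← hD _ (ofRealVec_mem_lieBall hx), diracOp, diracOp, (hd x hx).fderiv]
    simp [ofRealVec_single]

theorem injOn_restrictReal : InjOn restrictReal (complexRegular (lieBall (n + 1))) := by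
  rintro g₁ ⟨F₁, hFg₁, hF₁, -⟩ g₂ ⟨F₂, hFg₂, hF₂, -⟩ h
  funext ζ
  rw [← hFg₁, ← hFg₂, ← sub_eq_zero]
  have hd : DifferentiableOn ℂ (F₁ - F₂) {ζ | lieGauge ζ < 1} := by
    rw [← lieBall_eq_lieGauge_lt]
    exact (hF₁.differentiableOn one_ne_zero).sub (hF₂.differentiableOn one_ne_zero)
  have hζ : ζ.1 ∈ {ζ | lieGauge ζ < 1} := lieBall_eq_lieGauge_lt.subset ζ.2
  refine eq_zero_of_real_eq_zero hd (fun x hx => ?_) hζ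
  have hx1 : x ∈ ball (0 : EuclideanSpace ℝ (Fin (n + 1))) 1 := by
    simpa using (sq_lt_one_iff₀ (norm_nonneg x)).1 hx
  have h1 := congrFun h ⟨x, hx1⟩
  rw [Pi.sub_apply, sub_eq_zero]
  exact (hFg₁ ⟨_, ofRealVec_mem_lieBall hx1⟩).trans
    (h1.trans (hFg₂ ⟨_, ofRealVec_mem_lieBall hx1⟩).symm)

/-- The Cauchy integrals over two spheres agree on the smaller Lie ball. -/
theorem sphereIntegral_eq_sphereIntegral {f : EuclideanSpace ℝ (Fin (n + 1)) → Cliff n}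
    (hf : ContDiffOn ℝ 1 f (ball 0 1)) (hD : ∀ x ∈ ball 0 1, diracOp ℝ f x = 0) {r s : ℝ}
    (hr0 : 0 < r) (hr1 : r < 1) (hs0 : 0 < s) (hs1 : s < 1) {ζ : EuclideanSpace ℂ (Fin (n + 1))}
    (hr : lieGauge ζ < r ^ 2) (hs : lieGauge ζ < s ^ 2) :
    sphereIntegral f r ζ = sphereIntegral f s ζ := by
  have hd : DifferentiableOn ℂ (sphereIntegral f r - sphereIntegral f s)
      {ζ | lieGauge ζ < min (r ^ 2) (s ^ 2)} :=
    (((sphereIntegral_regular hf.continuousOn hr0 hr1).1.differentiableOn one_ne_zero).mono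
      fun z hz => lt_of_lt_of_le (show lieGauge z < _ from hz) (min_le_left _ _)).sub
    (((sphereIntegral_regular hf.continuousOn hs0 hs1).1.differentiableOn one_ne_zero).mono
      fun z hz => lt_of_lt_of_le (show lieGauge z < _ from hz) (min_le_right _ _))
  refine sub_eq_zero.1 (eq_zero_of_real_eq_zero hd (fun x hx => ?_) (lt_min hr hs))
  rw [Pi.sub_apply, sub_eq_zero,
    sphereIntegral_ofRealVec hf hD (lt_of_pow_lt_pow_left₀ 2 hr0.le (lt_min_iff.1 hx).1) hr1,
    sphereIntegral_ofRealVec hf hD (lt_of_pow_lt_pow_left₀ 2 hs0.le (lt_min_iff.1 hx).2) hs1]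

theorem exists_radius {t : ℝ} (ht0 : 0 ≤ t) (ht1 : t < 1) : ∃ r : ℝ, 0 < r ∧ r < 1 ∧ t < r ^ 2 := by
  obtain ⟨u, hu0, hu1⟩ := exists_between ht1
  exact ⟨√u, Real.sqrt_pos.2 (ht0.trans_lt hu0), (Real.sqrt_lt' one_pos).2 (by simpa using hu1),
    by rwa [Real.sq_sqrt (ht0.trans hu0.le)]⟩

/-- The Cauchy integral at `ζ` over a sphere of any admissible radius, depending on `ζ`, is locally the
integral over a fixed sphere, so it defines a complex regular extension of `f`. -/
theorem exists_extension {f : EuclideanSpace ℝ (Fin (n + 1)) → Cliff n}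
    (hf : ContDiffOn ℝ 1 f (ball 0 1)) (hD : ∀ x ∈ ball 0 1, diracOp ℝ f x = 0) :
    ∃ F : EuclideanSpace ℂ (Fin (n + 1)) → Cliff n, ContDiffOn ℂ 1 F (lieBall (n + 1)) ∧
      (∀ ζ ∈ lieBall (n + 1), diracOp ℂ F ζ = 0) ∧
      (∀ x ∈ ball (0 : EuclideanSpace ℝ (Fin (n + 1))) 1, F (ofRealVec x) = f x) ∧
      ∀ r, 0 < r → r < 1 → ∀ ζ, lieGauge ζ < r ^ 2 → F ζ = sphereIntegral f r ζ := by
  have hex : ∀ ζ : EuclideanSpace ℂ (Fin (n + 1)), ∃ r : ℝ, lieGauge ζ < 1 →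
      0 < r ∧ r < 1 ∧ lieGauge ζ < r ^ 2 := fun ζ => by
    by_cases h : lieGauge ζ < 1
    · obtain ⟨r, hr⟩ := exists_radius (lieGauge_nonneg ζ) h
      exact ⟨r, fun _ => hr⟩
    · -- outside the Lie ball the radius is irrelevant
      exact ⟨0, fun h' => absurd h' h⟩
  choose ρ hρ using hex
  have hF : ∀ r, 0 < r → r < 1 → ∀ ζ, lieGauge ζ < r ^ 2 →
      sphereIntegral f (ρ ζ) ζ = sphereIntegral f r ζ := fun r hr0 hr1 ζ hζ => by
    obtain ⟨h1, h2, h3⟩ := hρ ζ (hζ.trans (pow_lt_one₀ hr0.le hr1 two_ne_zero))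
    exact sphereIntegral_eq_sphereIntegral hf hD h1 h2 hr0 hr1 h3 hζ
  have hev : ∀ ζ ∈ lieBall (n + 1), ∃ r, 0 < r ∧ r < 1 ∧ lieGauge ζ < r ^ 2 ∧
      (fun ζ => sphereIntegral f (ρ ζ) ζ) =ᶠ[𝓝 ζ] sphereIntegral f r := fun ζ hζ => by
    rw [lieBall_eq_lieGauge_lt] at hζ
    obtain ⟨h1, h2, h3⟩ := hρ ζ hζ
    refine ⟨ρ ζ, h1, h2, h3, ?_⟩
    filter_upwards [(isOpen_lieGauge_lt _).mem_nhds h3] with z hz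
    exact hF _ h1 h2 z hz
  refine ⟨fun ζ => sphereIntegral f (ρ ζ) ζ, fun ζ hζ => ?_, fun ζ hζ => ?_, fun x hx => ?_, hF⟩
  · obtain ⟨r, hr0, hr1, hr, he⟩ := hev ζ hζ
    exact (((sphereIntegral_regular hf.continuousOn hr0 hr1).1.contDiffAt
      ((isOpen_lieGauge_lt _).mem_nhds hr)).congr_of_eventuallyEq he).contDiffWithinAt
  · obtain ⟨r, hr0, hr1, hr, he⟩ := hev ζ hζ
    rw [← (sphereIntegral_regular hf.continuousOn hr0 hr1).2 ζ hr, diracOp, diracOp, he.fderiv_eq]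
  · obtain ⟨r, hxr, hr1⟩ := exists_between (mem_ball_zero_iff.1 hx)
    have hr0 : 0 < r := (norm_nonneg x).trans_lt hxr
    have hg : lieGauge (ofRealVec x) < r ^ 2 := by
      rw [lieGauge_ofRealVec]
      gcongr
    exact (hF r hr0 hr1 _ hg).trans (sphereIntegral_ofRealVec hf hD hxr hr1)

theorem exists_cauchyIntegral_extension
    {f : ball (0 : EuclideanSpace ℝ (Fin (n + 1))) 1 → Cliff n}
    (hf : f ∈ leftMonogenic (ball (0 : EuclideanSpace ℝ (Fin (n + 1))) 1)) :
    ∃ g ∈ complexRegular (lieBall (n + 1)), restrictReal g = f ∧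
      ∀ (r : ℝ) (hr0 : 0 < r) (hr1 : r < 1) (ζ : lieBall (n + 1)),
        (∃ z ∈ lieBall (n + 1), (ζ : EuclideanSpace ℂ (Fin (n + 1))) = r • z) →
          Integrable (cauchyIntegrand hr0 hr1 f ζ) (surfaceMeasure n) ∧
          g ζ = cauchyIntegral hr0 hr1 f ζ := by
  obtain ⟨f', hff', hf', hD⟩ := hf
  obtain ⟨F, hF, hFD, hFf, hFr⟩ := exists_extension hf' hD
  refine ⟨fun ζ => F ζ, ⟨F, fun _ => rfl, hF, hFD⟩, ?_, fun r hr0 hr1 ζ hζ => ?_⟩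
  · funext x
    exact (hFf x x.2).trans (hff' x)
  · rw [exists_mem_lieBall_smul_eq_iff hr0] at hζ
    have h1 : cauchyIntegrand hr0 hr1 f ζ =
        fun ω : sphere (0 : EuclideanSpace ℝ (Fin (n + 1))) 1 =>
        cauchyKernelDiff (ofRealVec (r • (ω : EuclideanSpace ℝ (Fin (n + 1)))) - ζ.1) *
          toCliff (ofRealVec (ω : EuclideanSpace ℝ (Fin (n + 1)))) *
            f' (r • (ω : EuclideanSpace ℝ (Fin (n + 1)))) := by
      funext ω
      rw [cauchyIntegrand, cauchyKernel_eq, ← hff']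
    refine ⟨h1 ▸ integrable_cauchyKernel_mul hf'.continuousOn hr0 hr1 hζ, ?_⟩
    rw [cauchyIntegral, h1]
    exact hFr r hr0 hr1 ζ hζ

end Extension

end

end CliffordLie

theorem mainTheorem3 (n : ℕ) (hn : 1 ≤ n) :
    -- the set `κ(B_1(0))` is the Lie ball
    kappa (Metric.ball (0 : EuclideanSpace ℝ (Fin (n + 1))) 1) = lieBall (n + 1) ∧
    -- the same set in terms of the real and imaginary parts; it is open and connected
    kappa (Metric.ball (0 : EuclideanSpace ℝ (Fin (n + 1))) 1) =
      {ζ | ‖reVec ζ‖ ^ 2 + ‖imVec ζ‖ ^ 2 +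
        2 * √(‖reVec ζ‖ ^ 2 * ‖imVec ζ‖ ^ 2 - inner ℝ (reVec ζ) (imVec ζ) ^ 2) < 1} ∧
    IsOpen (lieBall (n + 1)) ∧
    IsConnected (lieBall (n + 1)) ∧
    -- real points
    (∀ x : EuclideanSpace ℝ (Fin (n + 1)), singularSet (ofRealVec x) = {x}) ∧
    ofRealVec '' Metric.ball (0 : EuclideanSpace ℝ (Fin (n + 1))) 1 ⊆
      kappa (Metric.ball (0 : EuclideanSpace ℝ (Fin (n + 1))) 1) ∧
    -- the section of the Lie ball by `{0} × ℂ^n`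
    lieBall (n + 1) ∩ {ζ | ζ 0 = 0} = zeroCons '' lieBall n ∧
    -- restriction is a bijection from `CR(L_{n+1})` onto `M(B_1(0))`
    Set.BijOn restrictReal (complexRegular (lieBall (n + 1)))
      (leftMonogenic (Metric.ball (0 : EuclideanSpace ℝ (Fin (n + 1))) 1)) ∧
    -- the unique complex regular extension is given by the Cauchy integral formula
    (∀ f ∈ leftMonogenic (Metric.ball (0 : EuclideanSpace ℝ (Fin (n + 1))) 1),
      ∃ g ∈ complexRegular (lieBall (n + 1)), restrictReal g = f ∧
        (∀ g' ∈ complexRegular (lieBall (n + 1)), restrictReal g' = f → g' = g) ∧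
        ∀ (r : ℝ) (hr0 : 0 < r) (hr1 : r < 1) (ζ : lieBall (n + 1)),
          (∃ z ∈ lieBall (n + 1), (ζ : EuclideanSpace ℂ (Fin (n + 1))) = r • z) →
            MeasureTheory.Integrable (cauchyIntegrand hr0 hr1 f ζ) (surfaceMeasure n) ∧
            g ζ = cauchyIntegral hr0 hr1 f ζ) := by
  have hkappa := kappa_ball_eq_lieGauge_lt hn
  refine ⟨hkappa.trans lieBall_eq_lieGauge_lt.symm, hkappa, isOpen_lieBall, isConnected_lieBall,
    singularSet_ofRealVec, ?_, lieBall_inter_zero_section n,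
    ⟨mapsTo_restrictReal, injOn_restrictReal, fun f hf => ?_⟩, fun f hf => ?_⟩
  · rintro _ ⟨x, hx, rfl⟩
    rw [hkappa, ← lieBall_eq_lieGauge_lt]
    exact ofRealVec_mem_lieBall hx
  · obtain ⟨g, hg, hgf, -⟩ := exists_cauchyIntegral_extension hf
    exact ⟨g, hg, hgf⟩
  · obtain ⟨g, hg, hgf, hcauchy⟩ := exists_cauchyIntegral_extension hf
    exact ⟨g, hg, hgf, fun g' hg' hgf' => injOn_restrictReal hg' hg (hgf'.trans hgf.symm), hcauchy⟩
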